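/- Let $d\ge 0$ be an integer. Equip $\mathbf C^{d+1}$ with the complex bilinear Minkowski product $x\cdot y=x^{(0)}y^{(0)}-x^{(1)}y^{(1)}-\cdots-x^{(d)}y^{(d)}$, and let $V_+=\{y\in\mathbf R^{d+1}: y^{(0)}>0,\ y\cdot y>0\}$ be the open future cone and $\mathrm T_+=\mathbf R^{d+1}+iV_+\subset\mathbf C^{d+1}$ the forward tube. Let $L_+(\mathbf C)$ be the connected complex Lorentz group in $d+1$ dimensions, i.e. the group of complex $(d+1)\times(d+1)$ matrices of determinant $1$ that preserve this product, with the topology induced from the space of matrices. Lemma (Hall--Wightman, all dimensions). Let $M\in L_+(\mathbf C)$ be such that $\mathrm T_+\cap M^{-1}\mathrm T_+\neq\emptyset$. Then there exists a continuous path $t\mapsto M(t)$ from the interval $[0,1]$ into $L_+(\mathbf C)$ such that $M(0)=1$, $M(1)=M$ and, for every $z\in \mathrm T_+\cap M^{-1}\mathrm T_+$ and every $t\in[0,1]$, $M(t)z\in \mathrm T_+$. -/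

import Mathlib

open scoped Matrix

/-- The Minkowski scalar product `x⁰y⁰ - x¹y¹ - ⋯ - xᵈyᵈ` on `R^{d+1}` (used for `R = ℝ` and, as a
bilinear form, for `R = ℂ`). -/
def minkowskiDot {R : Type*} [CommRing R] {d : ℕ} (x y : Fin (d + 1) → R) : R :=
  x 0 * y 0 - ∑ i : Fin d, x i.succ * y i.succ

/-- The open future cone `V₊` in real Minkowski space `ℝ^{d+1}`. -/
def futureCone (d : ℕ) : Set (Fin (d + 1) → ℝ) :=
  {x | 0 < x 0 ∧ 0 < minkowskiDot x x}

/-- The forward tube `T₊ = ℝ^{d+1} + i V₊` in `ℂ^{d+1}`. -/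
def forwardTube (d : ℕ) : Set (Fin (d + 1) → ℂ) :=
  {z | (fun i => (z i).im) ∈ futureCone d}

/-- The connected complex Lorentz group `L₊(ℂ)` in `d + 1` dimensions: the complex
`(d+1) × (d+1)` matrices of determinant `1` that preserve the complex bilinear Minkowski product.
It carries the topology induced from the space of matrices. -/
def complexLorentzGroup (d : ℕ) :
    Subgroup (Matrix.SpecialLinearGroup (Fin (d + 1)) ℂ) where
  carrier := {M | ∀ x y : Fin (d + 1) → ℂ,
    minkowskiDot (M.1 *ᵥ x) (M.1 *ᵥ y) = minkowskiDot x y}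
  one_mem' := by
    intro x y
    simp
  mul_mem' := by
    intro A B hA hB x y
    have h := hA (B.1 *ᵥ x) (B.1 *ᵥ y)
    rw [hB x y] at h
    simpa [Matrix.mulVec_mulVec] using h
  inv_mem' := by
    intro A hA x y
    have key : ∀ v : Fin (d + 1) → ℂ, A.1 *ᵥ ((A⁻¹).1 *ᵥ v) = v := by
      intro v
      have h : A.1 * (A⁻¹).1 = 1 := congrArg Subtype.val (mul_inv_cancel A)
      rw [Matrix.mulVec_mulVec, h, Matrix.one_mulVec]
    have h := hA ((A⁻¹).1 *ᵥ x) ((A⁻¹).1 *ᵥ y)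
    rw [key, key] at h
    exact h.symm

/-- The action `z ↦ M z` of `L₊(ℂ)` on complex Minkowski space `ℂ^{d+1}`. -/
def lorentzAct {d : ℕ} (M : complexLorentzGroup d) (z : Fin (d + 1) → ℂ) : Fin (d + 1) → ℂ :=
  (M : Matrix.SpecialLinearGroup (Fin (d + 1)) ℂ).1 *ᵥ z

/-!
The proof rests on a polar decomposition `M = Λ (C + iS)²`, where `Λ` is a real Lorentz matrix that
preserves the future cone, and the real commuting matrices `C`, `S` play the role of `cos X` and
`sin X` for a real antisymmetric `X` (`HasPolarDecomposition`, `hasPolarDecomposition`).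

Given the decomposition, the path is built in two parts (`joinedIn_of_polar`). The matrices
`(C + itS)² (C² + t²S²)⁻¹` join `1` to `W = (C + iS)²`, and the imaginary part of such a matrix
applied to `z` is a combination of the imaginary parts of `z` and `W z` whose coefficients are
nonnegative combinations of `1` and of the resolvent `(1 - (1 - t²) S²)⁻¹`. The resolvent preserves
the future cone (`resolvent_mem_futureCone`), so the path stays in the tube whenever both `z` and
`W z` lie in it (`joinedIn_one_sq`). From `W` to `Λ W` one follows a path in the restricted real
Lorentz group, which is path connected because its elements are products of spacelike reflections
and any two of these are joined (`joinedIn_orthochronousLorentz_one`).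

To find the decomposition one extracts a fourth root of `N = M̄⁻¹ M`, which is to be `e^{4iX}`. If
all eigenvalues of `N` are positive, a principal root exists as a real polynomial in `N`
(`IsImaginaryLorentz.exists_sqrt`); then `S` kills a causal vector
(`exists_causal_mulVec_eq_zero`), and this forces `Λ` to preserve the time orientation, because `z`
and `M z` are in the tube for some `z`. Otherwise the signature of the Minkowski product leaves only
one possibility: `N` has two real null eigenvectors whose eigenvalues are `μ`, `μ⁻¹` with `|μ| = 1`,
`μ ≠ 1` (`positiveEigenvalues_or_hasNullEigenpair`). Dividing `M` by a complex boost in the plane of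
these vectors leads back to the first situation, and the boost itself has an evident square root
(`hasPolarDecomposition_of_nullPair`).
-/

/-! ### The Minkowski product and its metric matrix -/

section Dot

variable {R : Type*} [CommRing R] {d : ℕ}

theorem minkowskiDot_comm (x y : Fin (d + 1) → R) : minkowskiDot x y = minkowskiDot y x := by
  simp only [minkowskiDot, mul_comm]

theorem minkowskiDot_add_left (x y z : Fin (d + 1) → R) :
    minkowskiDot (x + y) z = minkowskiDot x z + minkowskiDot y z := by
  simp only [minkowskiDot, Pi.add_apply, add_mul, Finset.sum_add_distrib]; ring

theorem minkowskiDot_smul_left (c : R) (x z : Fin (d + 1) → R) :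
    minkowskiDot (c • x) z = c * minkowskiDot x z := by
  simp only [minkowskiDot, Pi.smul_apply, smul_eq_mul, mul_sub, Finset.mul_sum, mul_assoc]

theorem minkowskiDot_add_right (x y z : Fin (d + 1) → R) :
    minkowskiDot z (x + y) = minkowskiDot z x + minkowskiDot z y := by
  rw [minkowskiDot_comm, minkowskiDot_add_left, minkowskiDot_comm x, minkowskiDot_comm y]

theorem minkowskiDot_smul_right (c : R) (x z : Fin (d + 1) → R) :
    minkowskiDot z (c • x) = c * minkowskiDot z x := by
  rw [minkowskiDot_comm, minkowskiDot_smul_left, minkowskiDot_comm]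

theorem minkowskiDot_neg_left (x z : Fin (d + 1) → R) :
    minkowskiDot (-x) z = - minkowskiDot x z := by
  rw [← neg_one_smul R x, minkowskiDot_smul_left]; ring

theorem minkowskiDot_neg_right (x z : Fin (d + 1) → R) :
    minkowskiDot z (-x) = - minkowskiDot z x := by
  rw [minkowskiDot_comm, minkowskiDot_neg_left, minkowskiDot_comm]

theorem minkowskiDot_sub_left (x y z : Fin (d + 1) → R) :
    minkowskiDot (x - y) z = minkowskiDot x z - minkowskiDot y z := by
  rw [sub_eq_add_neg, minkowskiDot_add_left, minkowskiDot_neg_left, ← sub_eq_add_neg]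

theorem minkowskiDot_sub_right (x y z : Fin (d + 1) → R) :
    minkowskiDot z (x - y) = minkowskiDot z x - minkowskiDot z y := by
  rw [sub_eq_add_neg, minkowskiDot_add_right, minkowskiDot_neg_right, ← sub_eq_add_neg]

theorem minkowskiDot_zero_left (z : Fin (d + 1) → R) : minkowskiDot 0 z = 0 := by
  simp [minkowskiDot]

theorem minkowskiDot_zero_right (z : Fin (d + 1) → R) : minkowskiDot z 0 = 0 := by
  simp [minkowskiDot]

/-- The matrix `diag(1, -1, …, -1)` of the Minkowski product. -/
def minkowskiMetric (R : Type*) [CommRing R] (d : ℕ) : Matrix (Fin (d + 1)) (Fin (d + 1)) R :=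
  Matrix.diagonal (Fin.cons 1 fun _ => -1)

theorem minkowskiDot_eq_dotProduct (x y : Fin (d + 1) → R) :
    minkowskiDot x y = x ⬝ᵥ (minkowskiMetric R d *ᵥ y) := by
  simp [minkowskiDot, minkowskiMetric, dotProduct, Matrix.mulVec_diagonal, Fin.sum_univ_succ,
    sub_eq_add_neg]

theorem minkowskiMetric_mul_self : minkowskiMetric R d * minkowskiMetric R d = 1 := by
  rw [minkowskiMetric, Matrix.diagonal_mul_diagonal, ← Matrix.diagonal_one]
  congr 1
  funext i
  refine Fin.cases ?_ (fun j => ?_) i <;> simp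

/-- The Minkowski product is nondegenerate. -/
theorem eq_of_forall_minkowskiDot {x y : Fin (d + 1) → R}
    (h : ∀ z, minkowskiDot z x = minkowskiDot z y) : x = y := by
  have h1 : minkowskiMetric R d *ᵥ x = minkowskiMetric R d *ᵥ y := by
    refine dotProduct_eq _ _ fun z => ?_
    rw [dotProduct_comm, ← minkowskiDot_eq_dotProduct, h, minkowskiDot_eq_dotProduct,
      dotProduct_comm]
  have h2 := congrArg (minkowskiMetric R d *ᵥ ·) h1
  simpa [Matrix.mulVec_mulVec, minkowskiMetric_mul_self] using h2

/-- The adjoint `η Aᵀ η` of a matrix with respect to the Minkowski product. -/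
def minkowskiAdj (A : Matrix (Fin (d + 1)) (Fin (d + 1)) R) :
    Matrix (Fin (d + 1)) (Fin (d + 1)) R :=
  minkowskiMetric R d * Aᵀ * minkowskiMetric R d

variable (A B : Matrix (Fin (d + 1)) (Fin (d + 1)) R)

theorem minkowskiDot_mulVec_left (x y : Fin (d + 1) → R) :
    minkowskiDot (A *ᵥ x) y = minkowskiDot x (minkowskiAdj A *ᵥ y) := by
  rw [minkowskiDot_eq_dotProduct, minkowskiDot_eq_dotProduct, Matrix.mulVec_mulVec, minkowskiAdj,
    ← mul_assoc, ← mul_assoc, minkowskiMetric_mul_self, one_mul, ← Matrix.mulVec_mulVec,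
    Matrix.mulVec_transpose, dotProduct_comm, Matrix.dotProduct_mulVec, dotProduct_comm]

theorem minkowskiAdj_unique (h : ∀ x y, minkowskiDot (A *ᵥ x) y = minkowskiDot x (B *ᵥ y)) :
    minkowskiAdj A = B := by
  refine Matrix.ext_of_mulVec_single fun i => eq_of_forall_minkowskiDot fun z => ?_
  rw [← minkowskiDot_mulVec_left, h]

theorem minkowskiAdj_mul : minkowskiAdj (A * B) = minkowskiAdj B * minkowskiAdj A := by
  refine minkowskiAdj_unique _ _ fun x y => ?_
  rw [← Matrix.mulVec_mulVec, ← Matrix.mulVec_mulVec, minkowskiDot_mulVec_left,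
    minkowskiDot_mulVec_left]

theorem minkowskiAdj_minkowskiAdj : minkowskiAdj (minkowskiAdj A) = A := by
  refine minkowskiAdj_unique _ _ fun x y => ?_
  rw [minkowskiDot_comm, ← minkowskiDot_mulVec_left, minkowskiDot_comm]

theorem minkowskiDot_mulVec_right (x y : Fin (d + 1) → R) :
    minkowskiDot x (A *ᵥ y) = minkowskiDot (minkowskiAdj A *ᵥ x) y := by
  rw [minkowskiDot_mulVec_left, minkowskiAdj_minkowskiAdj]

@[simp] theorem minkowskiAdj_one :
    minkowskiAdj (1 : Matrix (Fin (d + 1)) (Fin (d + 1)) R) = 1 := by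
  simp [minkowskiAdj, minkowskiMetric_mul_self]

theorem minkowskiAdj_add : minkowskiAdj (A + B) = minkowskiAdj A + minkowskiAdj B := by
  simp [minkowskiAdj, mul_add, add_mul]

theorem minkowskiAdj_sub : minkowskiAdj (A - B) = minkowskiAdj A - minkowskiAdj B := by
  simp [minkowskiAdj, mul_sub, sub_mul]

theorem minkowskiAdj_smul (c : R) : minkowskiAdj (c • A) = c • minkowskiAdj A := by
  simp [minkowskiAdj]

theorem det_minkowskiAdj : (minkowskiAdj A).det = A.det := by
  have h : (minkowskiMetric R d).det * (minkowskiMetric R d).det = 1 := by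
    rw [← Matrix.det_mul, minkowskiMetric_mul_self, Matrix.det_one]
  rw [minkowskiAdj, Matrix.det_mul, Matrix.det_mul, Matrix.det_transpose]
  linear_combination A.det * h

variable {A B}

theorem minkowskiDot_mulVec_mulVec (h : minkowskiAdj A * A = 1) (x y : Fin (d + 1) → R) :
    minkowskiDot (A *ᵥ x) (A *ᵥ y) = minkowskiDot x y := by
  rw [minkowskiDot_mulVec_left, Matrix.mulVec_mulVec, h, Matrix.one_mulVec]

theorem minkowskiAdj_mul_self_of_forall
    (h : ∀ x y, minkowskiDot (A *ᵥ x) (A *ᵥ y) = minkowskiDot x y) : minkowskiAdj A * A = 1 := by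
  refine Matrix.ext_of_mulVec_single fun i => eq_of_forall_minkowskiDot fun z => ?_
  rw [← Matrix.mulVec_mulVec, ← minkowskiDot_mulVec_left, h, Matrix.one_mulVec]

theorem minkowskiAdj_mul_self_mul (hA : minkowskiAdj A * A = 1) (hB : minkowskiAdj B * B = 1) :
    minkowskiAdj (A * B) * (A * B) = 1 := by
  rw [minkowskiAdj_mul, mul_assoc, ← mul_assoc _ A, hA, one_mul, hB]

theorem minkowskiDot_self_add (x y : Fin (d + 1) → R) :
    minkowskiDot (x + y) (x + y)
      = minkowskiDot x x + 2 * minkowskiDot x y + minkowskiDot y y := by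
  rw [minkowskiDot_add_left, minkowskiDot_add_right, minkowskiDot_add_right, minkowskiDot_comm y x]
  ring

/-- For an antisymmetric matrix, `x ⟂ A x`. -/
theorem minkowskiDot_self_mulVec {A : Matrix (Fin (d + 1)) (Fin (d + 1)) ℝ}
    (h : minkowskiAdj A = -A) (x : Fin (d + 1) → ℝ) : minkowskiDot x (A *ᵥ x) = 0 := by
  have := minkowskiDot_mulVec_left A x x
  rw [h, Matrix.neg_mulVec, minkowskiDot_neg_right, minkowskiDot_comm] at this
  linarith

theorem minkowskiDot_mulVec_skew {A : Matrix (Fin (d + 1)) (Fin (d + 1)) R}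
    (h : minkowskiAdj A = -A) (x y : Fin (d + 1) → R) :
    minkowskiDot x (A *ᵥ (A *ᵥ y)) = - minkowskiDot (A *ᵥ x) (A *ᵥ y) := by
  rw [minkowskiDot_mulVec_right, h, Matrix.neg_mulVec, minkowskiDot_neg_left]

end Dot

/-! ### Causality in real Minkowski space -/

section Causal

variable {d : ℕ} {x y : Fin (d + 1) → ℝ}

theorem minkowskiDot_self_le (x : Fin (d + 1) → ℝ) : minkowskiDot x x ≤ x 0 ^ 2 := by
  have : 0 ≤ ∑ i : Fin d, x i.succ * x i.succ :=
    Finset.sum_nonneg fun i _ => mul_self_nonneg _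
  simp only [minkowskiDot]; nlinarith

theorem eq_zero_of_minkowskiDot_self_nonneg (h0 : x 0 = 0) (h : 0 ≤ minkowskiDot x x) :
    x = 0 := by
  have h1 : 0 ≤ ∑ i : Fin d, x i.succ * x i.succ :=
    Finset.sum_nonneg fun i _ => mul_self_nonneg _
  have h2 : ∑ i : Fin d, x i.succ * x i.succ = 0 := by
    simp only [minkowskiDot, h0] at h; linarith
  rw [Finset.sum_eq_zero_iff_of_nonneg fun i _ => mul_self_nonneg _] at h2
  funext i
  refine Fin.cases h0 (fun j => ?_) i
  simpa using h2 j (Finset.mem_univ _)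

/-- A timelike or null vector and a causal vector orthogonal to it are proportional. -/
theorem exists_smul_of_minkowskiDot_eq_zero (hx0 : x ≠ 0) (hx : 0 ≤ minkowskiDot x x)
    (hxy : minkowskiDot x y = 0) (hy : 0 ≤ minkowskiDot y y) : ∃ c : ℝ, y = c • x := by
  have hx00 : x 0 ≠ 0 := fun h => hx0 (eq_zero_of_minkowskiDot_self_nonneg h hx)
  refine ⟨y 0 / x 0, ?_⟩
  rw [← sub_eq_zero]
  apply eq_zero_of_minkowskiDot_self_nonneg
  · simp [hx00]
  · rw [minkowskiDot_sub_left, minkowskiDot_sub_right, minkowskiDot_sub_right,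
      minkowskiDot_smul_left, minkowskiDot_smul_left, minkowskiDot_smul_right,
      minkowskiDot_smul_right, minkowskiDot_comm y x, hxy]
    have := mul_nonneg (sq_nonneg (y 0 / x 0)) hx
    nlinarith

theorem minkowskiDot_self_nonpos_of_orthogonal (hx0 : x ≠ 0) (hx : 0 ≤ minkowskiDot x x)
    (hxy : minkowskiDot x y = 0) : minkowskiDot y y ≤ 0 := by
  by_contra! hy
  obtain ⟨c, rfl⟩ := exists_smul_of_minkowskiDot_eq_zero hx0 hx hxy hy.le
  rw [minkowskiDot_smul_right] at hxy
  rw [minkowskiDot_smul_right, minkowskiDot_smul_left] at hy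
  rw [mul_left_comm, hxy] at hy
  simp at hy

theorem ne_zero_of_minkowskiDot_self_ne_zero (hx : minkowskiDot x x ≠ 0) : x ≠ 0 := by
  rintro rfl; simp [minkowskiDot_zero_left] at hx

theorem minkowskiDot_self_neg_of_orthogonal (hx : 0 < minkowskiDot x x)
    (hxy : minkowskiDot x y = 0) (hy : y ≠ 0) : minkowskiDot y y < 0 := by
  have hx0 := ne_zero_of_minkowskiDot_self_ne_zero hx.ne'
  refine lt_of_le_of_ne (minkowskiDot_self_nonpos_of_orthogonal hx0 hx.le hxy) fun h => hy ?_
  obtain ⟨c, rfl⟩ := exists_smul_of_minkowskiDot_eq_zero hx0 hx.le hxy h.ge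
  rw [minkowskiDot_smul_right] at hxy
  rw [(mul_eq_zero.mp hxy).resolve_right hx.ne', zero_smul]

theorem minkowskiDot_pos (hx : x ∈ futureCone d) (hy0 : 0 ≤ y 0) (hy : 0 ≤ minkowskiDot y y)
    (hyne : y ≠ 0) : 0 < minkowskiDot x y := by
  have hy0' : 0 < y 0 :=
    lt_of_le_of_ne hy0 fun h => hyne (eq_zero_of_minkowskiDot_self_nonneg h.symm hy)
  obtain ⟨hx0, hx⟩ := hx
  have cs := Finset.sum_mul_sq_le_sq_mul_sq Finset.univ (fun i : Fin d => x i.succ)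
    (fun i : Fin d => y i.succ)
  simp only [minkowskiDot, ← sq] at hx hy ⊢
  have hs : 0 ≤ ∑ i : Fin d, x i.succ ^ 2 := Finset.sum_nonneg fun i _ => sq_nonneg _
  have hs' : 0 ≤ ∑ i : Fin d, y i.succ ^ 2 := Finset.sum_nonneg fun i _ => sq_nonneg _
  have hlt : (∑ i : Fin d, x i.succ * y i.succ) ^ 2 < (x 0 * y 0) ^ 2 := by
    refine cs.trans_lt ?_
    have hxx : (0 : ℝ) < x 0 ^ 2 := by positivity
    have hyy : (0 : ℝ) < y 0 ^ 2 := by positivity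
    rw [mul_pow]
    nlinarith
  have := abs_lt_of_sq_lt_sq hlt (by positivity)
  linarith [(abs_lt.mp this).2]

theorem minkowskiDot_pos_of_mem (hx : x ∈ futureCone d) (hy : y ∈ futureCone d) :
    0 < minkowskiDot x y :=
  minkowskiDot_pos hx hy.1.le hy.2.le (ne_zero_of_minkowskiDot_self_ne_zero hy.2.ne')

theorem mem_futureCone_or_neg_mem (hx : 0 < minkowskiDot x x) :
    x ∈ futureCone d ∨ -x ∈ futureCone d := by
  have h0 : x 0 ≠ 0 := fun h => ne_zero_of_minkowskiDot_self_ne_zero hx.ne'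
    (eq_zero_of_minkowskiDot_self_nonneg h hx.le)
  rcases lt_or_gt_of_ne h0 with h | h
  · right
    refine ⟨by simpa using h, ?_⟩
    rwa [minkowskiDot_neg_left, minkowskiDot_neg_right, neg_neg]
  · exact Or.inl ⟨h, hx⟩

theorem mem_futureCone_of_minkowskiDot_pos (hx : x ∈ futureCone d) (hy : 0 < minkowskiDot y y)
    (hxy : 0 < minkowskiDot x y) : y ∈ futureCone d := by
  rcases mem_futureCone_or_neg_mem hy with h | h
  · exact h
  · have := minkowskiDot_pos_of_mem hx h
    rw [minkowskiDot_neg_right] at this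
    linarith

theorem smul_mem_futureCone {c : ℝ} (hc : 0 < c) (hx : x ∈ futureCone d) :
    c • x ∈ futureCone d := by
  refine ⟨by simpa using mul_pos hc hx.1, ?_⟩
  rw [minkowskiDot_smul_left, minkowskiDot_smul_right]
  exact mul_pos hc (mul_pos hc hx.2)

theorem add_mem_futureCone (hx : x ∈ futureCone d) (hy0 : 0 ≤ y 0)
    (hy : 0 ≤ minkowskiDot y y) : x + y ∈ futureCone d := by
  rcases eq_or_ne y 0 with rfl | hne
  · simpa using hx
  refine ⟨add_pos_of_pos_of_nonneg hx.1 hy0, ?_⟩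
  rw [minkowskiDot_self_add]
  linarith [hx.2, minkowskiDot_pos hx hy0 hy hne]

theorem continuous_minkowskiDot {X R : Type*} [TopologicalSpace X] [CommRing R]
    [TopologicalSpace R] [IsTopologicalRing R] {f g : X → Fin (d + 1) → R} (hf : Continuous f)
    (hg : Continuous g) : Continuous fun t => minkowskiDot (f t) (g t) := by
  unfold minkowskiDot
  fun_prop

theorem isOpen_futureCone : IsOpen (futureCone d) :=
  (isOpen_lt continuous_const (continuous_apply 0)).inter
    (isOpen_lt continuous_const (continuous_minkowskiDot continuous_id continuous_id))

theorem of_mem_closure_futureCone (hx : x ∈ closure (futureCone d)) :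
    0 ≤ x 0 ∧ 0 ≤ minkowskiDot x x := by
  have hc : IsClosed {x : Fin (d + 1) → ℝ | 0 ≤ x 0 ∧ 0 ≤ minkowskiDot x x} :=
    (isClosed_le continuous_const (continuous_apply 0)).inter
      (isClosed_le continuous_const (continuous_minkowskiDot continuous_id continuous_id))
  have hs : futureCone d ⊆ {x | 0 ≤ x 0 ∧ 0 ≤ minkowskiDot x x} :=
    fun y hy => ⟨hy.1.le, hy.2.le⟩
  exact closure_minimal hs hc hx

theorem timeAxis_mem_futureCone : (Pi.single 0 1 : Fin (d + 1) → ℝ) ∈ futureCone d := by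
  simp [futureCone, minkowskiDot]

end Causal

/-! ### Positivity of resolvents of antisymmetric matrices -/

/-- If `1 - c A²` stays invertible for `c` in `[0, c₀]`, with `A` antisymmetric, its inverse maps
the open future cone into itself: a solution `x` of `(1 - c A²) x = y` that reaches the boundary of
the cone is null, so `A x ⟂ x` is not timelike and `x · y = c (A x)² ≤ 0`, whereas `x · y > 0`. -/
theorem resolvent_mem_futureCone {d : ℕ} {A : Matrix (Fin (d + 1)) (Fin (d + 1)) ℝ}
    (hA : minkowskiAdj A = -A) {c₀ : ℝ} (hc₀ : 0 ≤ c₀)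
    (hdet : ∀ c ∈ Set.Icc 0 c₀, (1 - c • (A * A)).det ≠ 0) {y : Fin (d + 1) → ℝ}
    (hy : y ∈ futureCone d) : (1 - c₀ • (A * A))⁻¹ *ᵥ y ∈ futureCone d := by
  set x : ℝ → Fin (d + 1) → ℝ := fun c => (1 - c • (A * A))⁻¹ *ᵥ y with hxdef
  have hsolve : ∀ c ∈ Set.Icc 0 c₀, (1 - c • (A * A)) *ᵥ x c = y := fun c hc => by
    rw [hxdef, Matrix.mulVec_mulVec,
      Matrix.mul_nonsing_inv _ (isUnit_iff_ne_zero.mpr (hdet c hc)), Matrix.one_mulVec]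
  have hcont : ContinuousOn x (Set.Icc 0 c₀) := by
    have h1 : Continuous fun c : ℝ => 1 - c • (A * A) := by fun_prop
    simp only [hxdef, Matrix.inv_def, Ring.inverse_eq_inv']
    have h2 : ContinuousOn (fun c : ℝ => ((1 - c • (A * A)).det)⁻¹ • (1 - c • (A * A)).adjugate)
        (Set.Icc 0 c₀) :=
      (h1.matrix_det.continuousOn.inv₀ hdet).smul h1.matrix_adjugate.continuousOn
    have h3 : Continuous fun B : Matrix (Fin (d + 1)) (Fin (d + 1)) ℝ => B *ᵥ y := by fun_prop
    exact h3.comp_continuousOn h2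
  have hx0 : x 0 ∈ futureCone d := by simpa [hxdef] using hy
  have hsub : x '' Set.Icc 0 c₀ ⊆ futureCone d := by
    refine (isPreconnected_Icc.image x hcont).subset_of_closure_inter_subset isOpen_futureCone
      ⟨x 0, Set.mem_image_of_mem x ⟨le_rfl, hc₀⟩, hx0⟩ ?_
    rintro _ ⟨hcl, c, hc, rfl⟩
    obtain ⟨h0, hnn⟩ := of_mem_closure_futureCone hcl
    have hs := hsolve c hc
    have hne : x c ≠ 0 := fun h => by
      rw [h, Matrix.mulVec_zero] at hs
      exact ne_zero_of_minkowskiDot_self_ne_zero hy.2.ne' hs.symm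
    have hpos := minkowskiDot_pos hy h0 hnn hne
    rcases hnn.lt_or_eq with h | h
    · refine ⟨lt_of_le_of_ne h0 fun h' => hne (eq_zero_of_minkowskiDot_self_nonneg h'.symm hnn), h⟩
    · have h2 := minkowskiDot_self_nonpos_of_orthogonal hne hnn
        (minkowskiDot_self_mulVec hA (x c))
      rw [minkowskiDot_comm, ← hs, Matrix.sub_mulVec, Matrix.one_mulVec, Matrix.smul_mulVec,
        ← Matrix.mulVec_mulVec, minkowskiDot_sub_right, minkowskiDot_smul_right,
        minkowskiDot_mulVec_skew hA, ← h] at hpos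
      nlinarith [hc.1]
  exact hsub ⟨c₀, ⟨hc₀, le_rfl⟩, rfl⟩

/-! ### Real and complex matrices -/

section Complexify

variable {d : ℕ}

/-- Complexification of real matrices, as a homomorphism of real algebras. -/
noncomputable def complexify (d : ℕ) :
    Matrix (Fin (d + 1)) (Fin (d + 1)) ℝ →ₐ[ℝ] Matrix (Fin (d + 1)) (Fin (d + 1)) ℂ :=
  Complex.ofRealAm.mapMatrix

/-- Entrywise complex conjugation of matrices, as a homomorphism of real algebras. -/
noncomputable def conjMatrix (d : ℕ) :
    Matrix (Fin (d + 1)) (Fin (d + 1)) ℂ →ₐ[ℝ] Matrix (Fin (d + 1)) (Fin (d + 1)) ℂ :=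
  (Complex.conjAe : ℂ →ₐ[ℝ] ℂ).mapMatrix

theorem complexify_apply (A : Matrix (Fin (d + 1)) (Fin (d + 1)) ℝ) (i j : Fin (d + 1)) :
    complexify d A i j = (A i j : ℂ) := rfl

theorem conjMatrix_apply (A : Matrix (Fin (d + 1)) (Fin (d + 1)) ℂ) (i j : Fin (d + 1)) :
    conjMatrix d A i j = (starRingEnd ℂ) (A i j) := rfl

theorem conjMatrix_conjMatrix (A : Matrix (Fin (d + 1)) (Fin (d + 1)) ℂ) :
    conjMatrix d (conjMatrix d A) = A := by
  ext i j; simp [conjMatrix_apply]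

theorem conjMatrix_smul (c : ℂ) (A : Matrix (Fin (d + 1)) (Fin (d + 1)) ℂ) :
    conjMatrix d (c • A) = (starRingEnd ℂ) c • conjMatrix d A := by
  ext i j; simp [conjMatrix_apply]

theorem conjMatrix_mulVec (A : Matrix (Fin (d + 1)) (Fin (d + 1)) ℂ) (v : Fin (d + 1) → ℂ) :
    conjMatrix d A *ᵥ star v = star (A *ᵥ v) := by
  funext i; simp [Matrix.mulVec, dotProduct, conjMatrix_apply]

theorem exists_complexify_eq {A : Matrix (Fin (d + 1)) (Fin (d + 1)) ℂ}
    (h : conjMatrix d A = A) : ∃ B, complexify d B = A := by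
  refine ⟨A.map Complex.re, ?_⟩
  ext i j
  have := congrFun (congrFun h i) j
  rw [conjMatrix_apply, Complex.conj_eq_iff_re] at this
  rw [complexify_apply, Matrix.map_apply, this]

theorem complexify_injective : Function.Injective (complexify d) := fun A B h => by
  ext i j
  exact Complex.ofReal_injective (congrFun (congrFun h i) j)

theorem minkowskiAdj_complexify (A : Matrix (Fin (d + 1)) (Fin (d + 1)) ℝ) :
    minkowskiAdj (complexify d A) = complexify d (minkowskiAdj A) := by
  have h : minkowskiMetric ℂ d = complexify d (minkowskiMetric ℝ d) := by
    ext i j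
    simp only [minkowskiMetric, complexify_apply, Matrix.diagonal_apply]
    split_ifs
    · refine Fin.cases ?_ (fun j => ?_) i <;> simp
    · simp
  simp only [minkowskiAdj, map_mul, h]
  rfl

theorem minkowskiAdj_conjMatrix (A : Matrix (Fin (d + 1)) (Fin (d + 1)) ℂ) :
    minkowskiAdj (conjMatrix d A) = conjMatrix d (minkowskiAdj A) := by
  have h : minkowskiMetric ℂ d = conjMatrix d (minkowskiMetric ℂ d) := by
    ext i j
    simp only [minkowskiMetric, conjMatrix_apply, Matrix.diagonal_apply]
    split_ifs
    · refine Fin.cases ?_ (fun j => ?_) i <;> simp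
    · simp
  simp only [minkowskiAdj, map_mul]
  rw [← h]
  rfl

theorem det_complexify (A : Matrix (Fin (d + 1)) (Fin (d + 1)) ℝ) :
    (complexify d A).det = (A.det : ℂ) :=
  (AlgHom.map_det Complex.ofRealAm A).symm

theorem det_conjMatrix (A : Matrix (Fin (d + 1)) (Fin (d + 1)) ℂ) :
    (conjMatrix d A).det = (starRingEnd ℂ) A.det :=
  (AlgHom.map_det (Complex.conjAe : ℂ →ₐ[ℝ] ℂ) A).symm

/-- A real vector viewed as a complex one. -/
def ofRealVec (x : Fin (d + 1) → ℝ) : Fin (d + 1) → ℂ := fun i => (x i : ℂ)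

/-- The imaginary part of a complex vector. -/
def imVec (z : Fin (d + 1) → ℂ) : Fin (d + 1) → ℝ := fun i => (z i).im

/-- The real part of a complex vector. -/
def reVec (z : Fin (d + 1) → ℂ) : Fin (d + 1) → ℝ := fun i => (z i).re

theorem mem_forwardTube_iff {z : Fin (d + 1) → ℂ} :
    z ∈ forwardTube d ↔ imVec z ∈ futureCone d := Iff.rfl

theorem ofRealVec_re_add_im (z : Fin (d + 1) → ℂ) :
    ofRealVec (reVec z) + Complex.I • ofRealVec (imVec z) = z := by
  funext i
  simp [ofRealVec, reVec, imVec, mul_comm Complex.I]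

theorem imVec_add_smul (x y : Fin (d + 1) → ℝ) :
    imVec (ofRealVec x + Complex.I • ofRealVec y) = y := by
  funext i; simp [imVec, ofRealVec]

theorem complexify_mulVec_ofRealVec (A : Matrix (Fin (d + 1)) (Fin (d + 1)) ℝ)
    (x : Fin (d + 1) → ℝ) : complexify d A *ᵥ ofRealVec x = ofRealVec (A *ᵥ x) := by
  funext i; simp [Matrix.mulVec, dotProduct, complexify_apply, ofRealVec]

theorem imVec_complexify_mulVec (A : Matrix (Fin (d + 1)) (Fin (d + 1)) ℝ)
    (z : Fin (d + 1) → ℂ) : imVec (complexify d A *ᵥ z) = A *ᵥ imVec z := by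
  conv_lhs => rw [← ofRealVec_re_add_im z]
  rw [Matrix.mulVec_add, Matrix.mulVec_smul, complexify_mulVec_ofRealVec,
    complexify_mulVec_ofRealVec, imVec_add_smul]

theorem imVec_smul_I (z : Fin (d + 1) → ℂ) : imVec (Complex.I • z) = reVec z := by
  funext i; simp [imVec, reVec]

theorem imVec_add (z w : Fin (d + 1) → ℂ) : imVec (z + w) = imVec z + imVec w := by
  funext i; simp [imVec]

theorem reVec_complexify_mulVec (A : Matrix (Fin (d + 1)) (Fin (d + 1)) ℝ)
    (z : Fin (d + 1) → ℂ) : reVec (complexify d A *ᵥ z) = A *ᵥ reVec z := by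
  rw [← imVec_smul_I, ← Matrix.mulVec_smul, imVec_complexify_mulVec, imVec_smul_I]

theorem minkowskiDot_ofRealVec (x y : Fin (d + 1) → ℝ) :
    minkowskiDot (ofRealVec x) (ofRealVec y) = ((minkowskiDot x y : ℝ) : ℂ) := by
  simp [minkowskiDot, ofRealVec]

theorem im_minkowskiDot_ofRealVec (x : Fin (d + 1) → ℝ) (z : Fin (d + 1) → ℂ) :
    (minkowskiDot (ofRealVec x) z).im = minkowskiDot x (imVec z) := by
  simp [minkowskiDot, ofRealVec, imVec]

theorem ofRealVec_injective : Function.Injective (ofRealVec (d := d)) := fun x y h => by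
  funext i; exact Complex.ofReal_injective (congrFun h i)

theorem ofRealVec_ne_zero {x : Fin (d + 1) → ℝ} (hx : x ≠ 0) : ofRealVec x ≠ 0 := fun h =>
  hx (ofRealVec_injective (h.trans (by funext i; simp [ofRealVec])))

theorem star_ofRealVec (x : Fin (d + 1) → ℝ) : star (ofRealVec x) = ofRealVec x := by
  funext i; simp [ofRealVec]

theorem exists_ofRealVec_eq {z : Fin (d + 1) → ℂ} (h : star z = z) : ∃ x, ofRealVec x = z := by
  refine ⟨reVec z, funext fun i => ?_⟩
  have := congrFun h i
  rw [Pi.star_apply, Complex.star_def, Complex.conj_eq_iff_re] at this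
  exact this

theorem star_minkowskiDot (z w : Fin (d + 1) → ℂ) :
    minkowskiDot (star z) (star w) = (starRingEnd ℂ) (minkowskiDot z w) := by
  simp [minkowskiDot]

/-- The element of the complex Lorentz group with a given matrix. -/
def lorentzOfMatrix (A : Matrix (Fin (d + 1)) (Fin (d + 1)) ℂ) (hA : minkowskiAdj A * A = 1)
    (hdet : A.det = 1) : complexLorentzGroup d :=
  ⟨⟨A, hdet⟩, fun x y => minkowskiDot_mulVec_mulVec hA x y⟩

theorem minkowskiAdj_inv {R : Type*} [CommRing R] {A : Matrix (Fin (d + 1)) (Fin (d + 1)) R}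
    (h : IsUnit A.det) : minkowskiAdj A⁻¹ = (minkowskiAdj A)⁻¹ := by
  refine (Matrix.inv_eq_left_inv ?_).symm
  rw [← minkowskiAdj_mul, Matrix.mul_nonsing_inv _ h, minkowskiAdj_one]

end Complexify

/-! ### The path from the identity to the square of a complex rotation -/

section ImaginaryPath

variable {d : ℕ} {C S : Matrix (Fin (d + 1)) (Fin (d + 1)) ℝ}

/-- For commuting `C` and `S`, with `C` selfadjoint and `S` antisymmetric, `(C + iS)(C - iS)`. -/
theorem minkowskiAdj_mul_add_I_smul (hC : minkowskiAdj C = C) (hS : minkowskiAdj S = -S)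
    (hCS : Commute C S) :
    minkowskiAdj (complexify d C + Complex.I • complexify d S)
      * (complexify d C + Complex.I • complexify d S) = complexify d (C * C + S * S) := by
  have hc : complexify d C * complexify d S = complexify d S * complexify d C := by
    rw [← map_mul, hCS.eq, map_mul]
  rw [minkowskiAdj_add, minkowskiAdj_smul, minkowskiAdj_complexify, minkowskiAdj_complexify,
    hC, hS, map_neg, map_add, map_mul, map_mul]
  simp only [add_mul, mul_add, smul_neg, neg_mul, Matrix.smul_mul, Matrix.mul_smul, smul_smul,
    Complex.I_mul_I, hc, neg_smul, one_smul]
  abel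

/-- Let `C = cos X` and `S = sin X` for a real antisymmetric `X`, so that `W = (C + iS)²` is
`e^{2iX}`. As `t` runs from `0` to `1`, `(C + itS)² (C² + t²S²)⁻¹` runs from `1` to `W` in the
complex Lorentz group. If `p` and `q` are the imaginary parts of `z` and of `W z`, the imaginary
part of its value on `z` is, with `D = C² + t²S² = 1 - (1 - t²) S²`,
`(1 - t)/(1 + t) p + D⁻¹ (t q + t (1 - t)/(1 + t) p)`, and `D⁻¹` preserves the future cone. -/
theorem joinedIn_one_sq (hC : minkowskiAdj C = C) (hS : minkowskiAdj S = -S)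
    (hCS : Commute C S) (h1 : C * C + S * S = 1)
    (hdet : ∀ c ∈ Set.Icc (0 : ℝ) 1, (1 - c • (S * S)).det ≠ 0)
    (W : complexLorentzGroup d)
    (hW : W.1.1 = (complexify d C + Complex.I • complexify d S)
      * (complexify d C + Complex.I • complexify d S)) :
    JoinedIn {A : complexLorentzGroup d | ∀ z ∈ forwardTube d,
      lorentzAct W z ∈ forwardTube d → lorentzAct A z ∈ forwardTube d} 1 W := by
  have hCC : C * C = 1 - S * S := eq_sub_of_add_eq h1
  set D : ℝ → Matrix (Fin (d + 1)) (Fin (d + 1)) ℝ := fun t => 1 - (1 - t ^ 2) • (S * S) with hD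
  have hDeq : ∀ t, C * C + (t • S) * (t • S) = D t := fun t => by
    rw [hCC, hD]
    simp only [Matrix.smul_mul, Matrix.mul_smul, smul_smul, sub_smul, one_smul, sq]
    abel
  have hmem : ∀ t : unitInterval, (1 - (t : ℝ) ^ 2) ∈ Set.Icc (0 : ℝ) 1 := fun t =>
    ⟨by nlinarith [t.2.1, t.2.2], by nlinarith [t.2.1, t.2.2]⟩
  have hDdet : ∀ t : unitInterval, (D t).det ≠ 0 := fun t => hdet _ (hmem t)
  have hDu : ∀ t : unitInterval, IsUnit (D t).det := fun t => isUnit_iff_ne_zero.mpr (hDdet t)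
  have hDadj : ∀ t, minkowskiAdj (D t) = D t := fun t => by
    rw [hD, minkowskiAdj_sub, minkowskiAdj_one, minkowskiAdj_smul, minkowskiAdj_mul, hS,
      neg_mul_neg]
  set E : ℝ → Matrix (Fin (d + 1)) (Fin (d + 1)) ℂ := fun t =>
    complexify d C + Complex.I • complexify d (t • S) with hE
  have hEE : ∀ t, minkowskiAdj (E t) * E t = complexify d (D t) := fun t => by
    rw [hE, minkowskiAdj_mul_add_I_smul hC (by rw [minkowskiAdj_smul, hS, smul_neg])
      (hCS.smul_right t), hDeq]
  have hSD : ∀ t, Commute S (D t) := fun t =>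
    (Commute.one_right S).sub_right (((Commute.refl S).mul_right (Commute.refl S)).smul_right _)
  have hCD : ∀ t, Commute C (D t) := fun t =>
    (Commute.one_right C).sub_right ((hCS.mul_right hCS).smul_right _)
  have hED : ∀ t, Commute (E t) (complexify d (D t)) := fun t => by
    refine Commute.add_left ((hCD t).map (complexify d)) (Commute.smul_left ?_ _)
    exact (((hSD t).smul_left t).map (complexify d))
  set F : ℝ → Matrix (Fin (d + 1)) (Fin (d + 1)) ℂ := fun t =>
    E t * E t * complexify d (D t)⁻¹ with hF
  have hFadj : ∀ t : unitInterval, minkowskiAdj (F t) * F t = 1 := fun t => by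
    have e1 : minkowskiAdj (F t) * F t = complexify d (D t)⁻¹ *
        (minkowskiAdj (E t) * (minkowskiAdj (E t) * E t) * E t) * complexify d (D t)⁻¹ := by
      simp only [hF]
      rw [minkowskiAdj_mul, minkowskiAdj_mul, minkowskiAdj_complexify,
        minkowskiAdj_inv (hDu t), hDadj]
      noncomm_ring
    rw [e1, hEE, mul_assoc (minkowskiAdj _), ← (hED t).eq, ← mul_assoc (minkowskiAdj _), hEE,
      ← map_mul, ← map_mul, ← map_mul, ← mul_assoc, Matrix.nonsing_inv_mul _ (hDu t), one_mul,
      Matrix.mul_nonsing_inv _ (hDu t), map_one]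
  have hFdet : ∀ t : unitInterval, (F t).det = 1 := fun t => by
    have e1 : (E t).det * (E t).det = ((D t).det : ℂ) := by
      rw [← det_complexify, ← hEE, Matrix.det_mul, det_minkowskiAdj]
    simp only [hF]
    rw [Matrix.det_mul, Matrix.det_mul, e1, det_complexify, ← Complex.ofReal_mul,
      ← Matrix.det_mul, Matrix.mul_nonsing_inv _ (hDu t), Matrix.det_one, Complex.ofReal_one]
  have hFcont : Continuous fun t : unitInterval => F t := by
    have c1 : Continuous fun t : unitInterval => D t := by fun_prop
    have c2 : Continuous fun t : unitInterval => (D t)⁻¹ := by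
      simp only [Matrix.inv_def, Ring.inverse_eq_inv']
      exact (c1.matrix_det.inv₀ hDdet).smul c1.matrix_adjugate
    have c3 : Continuous (complexify d) :=
      continuous_matrix fun i j => Complex.continuous_ofReal.comp (continuous_apply_apply i j)
    have c4 : Continuous fun t : unitInterval => E t := by
      have c5 : Continuous fun t : unitInterval => (t : ℝ) • S := by fun_prop
      have c6 : Continuous fun t : unitInterval => complexify d ((t : ℝ) • S) := c3.comp c5
      exact continuous_const.add (c6.const_smul Complex.I)
    exact (c4.mul c4).mul (c3.comp c2)
  have hF0 : F 0 = 1 := by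
    have e0 : D 0 = C * C := by simpa using (hDeq 0).symm
    have e1 : IsUnit (D 0).det := hDu 0
    simp only [hF, hE, zero_smul, map_zero, smul_zero, add_zero]
    rw [← map_mul, ← map_mul, ← e0, Matrix.mul_nonsing_inv _ e1, map_one]
  have hF1 : F 1 = W.1.1 := by
    have e0 : D 1 = 1 := by simp [hD]
    simp only [hF, hE, one_smul]
    rw [hW, e0, inv_one, map_one, mul_one]
  refine ⟨⟨⟨fun t => lorentzOfMatrix (F t) (hFadj t) (hFdet t),
    (hFcont.subtype_mk _).subtype_mk _⟩, ?_, ?_⟩, ?_⟩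
  · exact Subtype.ext (Subtype.ext hF0)
  · exact Subtype.ext (Subtype.ext hF1)
  intro t z hz hWz
  rcases eq_or_lt_of_le t.2.1 with h0 | h0
  · have : F t *ᵥ z = z := by rw [← h0, hF0, Matrix.one_mulVec]
    change F t *ᵥ z ∈ forwardTube d
    rwa [this]
  change imVec z ∈ futureCone d at hz
  change imVec (W.1.1 *ᵥ z) ∈ futureCone d at hWz
  change imVec (F t *ᵥ z) ∈ futureCone d
  set p := imVec z
  set q := imVec (W.1.1 *ᵥ z) with hq
  -- the imaginary part of `(C + isS)² w` for real `s`
  have him : ∀ (s : ℝ) (w : Fin (d + 1) → ℂ), imVec ((E s * E s) *ᵥ w)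
      = (C * C - s ^ 2 • (S * S)) *ᵥ imVec w + (2 * s) • ((C * S) *ᵥ reVec w) := by
    intro s w
    have e1 : E s * E s = complexify d (C * C - s ^ 2 • (S * S))
        + Complex.I • complexify d ((2 * s) • (C * S)) := by
      simp only [hE, map_sub, map_mul, map_smul, add_mul, mul_add, Matrix.smul_mul,
        Matrix.mul_smul, ← smul_add]
      rw [← map_mul, ← map_mul, ← map_mul, ← map_mul, hCS.eq]
      ext i j
      simp only [Matrix.add_apply, Matrix.sub_apply, Matrix.smul_apply, smul_eq_mul,
        Complex.real_smul]
      push_cast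
      linear_combination (s : ℂ) ^ 2 * complexify d (S * S) i j * Complex.I_mul_I
    rw [e1, Matrix.add_mulVec, imVec_add, imVec_complexify_mulVec, Matrix.smul_mulVec,
      imVec_smul_I, reVec_complexify_mulVec, Matrix.smul_mulVec]
  have hDF : D t *ᵥ imVec (F t *ᵥ z)
      = (t : ℝ) • q + (1 - (t : ℝ)) • ((1 - (1 - (t : ℝ)) • (S * S)) *ᵥ p) := by
    have e1 : complexify d (D t) *ᵥ (F t *ᵥ z) = (E t * E t) *ᵥ z := by
      rw [Matrix.mulVec_mulVec]
      simp only [hF]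
      rw [← mul_assoc, ← ((hED t).mul_left (hED t)).eq, mul_assoc, ← map_mul,
        Matrix.mul_nonsing_inv _ (hDu t), map_one, mul_one]
    have e2 : q = (C * C - S * S) *ᵥ p + (2 : ℝ) • ((C * S) *ᵥ reVec z) := by
      have : W.1.1 = E 1 * E 1 := by rw [hW]; simp [hE]
      rw [hq, this, him]; simp [p]
    rw [← imVec_complexify_mulVec, e1, him, e2, hCC]
    simp only [Matrix.sub_mulVec, Matrix.smul_mulVec, Matrix.one_mulVec]
    module
  have ht : (0 : ℝ) < 1 + t := by positivity
  have hfin : imVec (F t *ᵥ z) = (D t)⁻¹ *ᵥ ((t : ℝ) • q + ((t : ℝ) * (1 - t) / (1 + t)) • p)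
      + ((1 - (t : ℝ)) / (1 + t)) • p := by
    have e1 : imVec (F t *ᵥ z) = (D t)⁻¹ *ᵥ (D t *ᵥ imVec (F t *ᵥ z)) := by
      rw [Matrix.mulVec_mulVec, Matrix.nonsing_inv_mul _ (hDu t), Matrix.one_mulVec]
    have e2 : ((1 - (t : ℝ)) / (1 + t)) • p
        = (D t)⁻¹ *ᵥ (((1 - (t : ℝ)) / (1 + t)) • (D t *ᵥ p)) := by
      rw [Matrix.mulVec_smul, Matrix.mulVec_mulVec, Matrix.nonsing_inv_mul _ (hDu t),
        Matrix.one_mulVec]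
    rw [e1, hDF, e2, ← Matrix.mulVec_add]
    congr 1
    simp only [hD, Matrix.sub_mulVec, Matrix.smul_mulVec, Matrix.one_mulVec]
    match_scalars <;> field_simp <;> ring
  have hc : 0 ≤ (1 - (t : ℝ)) / (1 + t) := div_nonneg (by linarith [t.2.2]) ht.le
  have hc' : 0 ≤ (t : ℝ) * (1 - t) / (1 + t) :=
    div_nonneg (mul_nonneg h0.le (by linarith [t.2.2])) ht.le
  have hnn : ∀ c : ℝ, 0 ≤ c → 0 ≤ (c • p) 0 ∧ 0 ≤ minkowskiDot (c • p) (c • p) := fun c hc => by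
    refine ⟨mul_nonneg hc hz.1.le, ?_⟩
    rw [minkowskiDot_smul_left, minkowskiDot_smul_right]
    exact mul_nonneg hc (mul_nonneg hc hz.2.le)
  rw [hfin]
  refine add_mem_futureCone ?_ (hnn _ hc).1 (hnn _ hc).2
  refine resolvent_mem_futureCone hS (hmem t).1
    (fun c hc => hdet c ⟨hc.1, hc.2.trans (hmem t).2⟩) ?_
  exact add_mem_futureCone (smul_mem_futureCone h0 hWz) (hnn _ hc').1 (hnn _ hc').2

end ImaginaryPath

/-! ### Reflections and the connectedness of the restricted real Lorentz group -/

section Reflection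

variable {K : Type*} [Field K] {d : ℕ}

/-- The matrix of the Minkowski reflection `x ↦ x - 2 (u·x)/(u·u) u`; it is meaningful when
`u·u ≠ 0`. -/
def minkowskiReflection (u : Fin (d + 1) → K) : Matrix (Fin (d + 1)) (Fin (d + 1)) K :=
  1 - (2 / minkowskiDot u u) • Matrix.vecMulVec u (minkowskiMetric K d *ᵥ u)

theorem minkowskiReflection_mulVec (u x : Fin (d + 1) → K) :
    minkowskiReflection u *ᵥ x = x - (2 / minkowskiDot u u * minkowskiDot u x) • u := by
  rw [minkowskiReflection, Matrix.sub_mulVec, Matrix.one_mulVec, Matrix.smul_mulVec,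
    Matrix.vecMulVec_mulVec, minkowskiDot_comm u x, minkowskiDot_eq_dotProduct x u,
    dotProduct_comm, op_smul_eq_smul, smul_smul]

theorem minkowskiReflection_neg (u : Fin (d + 1) → K) :
    minkowskiReflection (-u) = minkowskiReflection u := by
  refine Matrix.ext_of_mulVec_single fun i => ?_
  rw [minkowskiReflection_mulVec, minkowskiReflection_mulVec]
  simp only [minkowskiDot_neg_left, minkowskiDot_neg_right, neg_neg]
  module

theorem minkowskiAdj_minkowskiReflection (u : Fin (d + 1) → K) :
    minkowskiAdj (minkowskiReflection u) = minkowskiReflection u := by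
  refine minkowskiAdj_unique _ _ fun x y => ?_
  simp only [minkowskiReflection_mulVec, minkowskiDot_sub_left, minkowskiDot_sub_right,
    minkowskiDot_smul_left, minkowskiDot_smul_right, minkowskiDot_comm u x]
  ring

theorem minkowskiReflection_mul_self {u : Fin (d + 1) → K} (hu : minkowskiDot u u ≠ 0) :
    minkowskiReflection u * minkowskiReflection u = 1 := by
  refine Matrix.ext_of_mulVec_single fun i => ?_
  rw [← Matrix.mulVec_mulVec, Matrix.one_mulVec]
  simp only [minkowskiReflection_mulVec, minkowskiDot_sub_right, minkowskiDot_smul_right]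
  match_scalars
  · ring
  · field_simp
    ring

theorem det_minkowskiReflection {u : Fin (d + 1) → K} (hu : minkowskiDot u u ≠ 0) :
    (minkowskiReflection u).det = -1 := by
  rw [minkowskiReflection, sub_eq_add_neg, ← neg_smul, ← Matrix.smul_vecMulVec,
    Matrix.vecMulVec_eq Unit, Matrix.det_one_add_replicateCol_mul_replicateRow,
    dotProduct_smul, dotProduct_comm, ← minkowskiDot_eq_dotProduct, smul_eq_mul]
  field_simp
  ring

end Reflection

section RealLorentz

variable {d : ℕ}

/-- The real orthochronous Lorentz group: the real matrices that preserve the Minkowski product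
and the open future cone. -/
def orthochronousLorentz (d : ℕ) : Set (Matrix (Fin (d + 1)) (Fin (d + 1)) ℝ) :=
  {A | minkowskiAdj A * A = 1 ∧ ∀ x ∈ futureCone d, A *ᵥ x ∈ futureCone d}

theorem mul_mem_orthochronousLorentz {A B : Matrix (Fin (d + 1)) (Fin (d + 1)) ℝ}
    (hA : A ∈ orthochronousLorentz d) (hB : B ∈ orthochronousLorentz d) :
    A * B ∈ orthochronousLorentz d := by
  refine ⟨minkowskiAdj_mul_self_mul hA.1 hB.1, fun x hx => ?_⟩
  rw [← Matrix.mulVec_mulVec]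
  exact hA.2 _ (hB.2 _ hx)

/-- A Lorentz matrix is orthochronous as soon as it sends one future vector to a future vector. -/
theorem mem_orthochronousLorentz_of_mem {A : Matrix (Fin (d + 1)) (Fin (d + 1)) ℝ}
    (hA : minkowskiAdj A * A = 1) {x : Fin (d + 1) → ℝ} (hx : x ∈ futureCone d)
    (hAx : A *ᵥ x ∈ futureCone d) : A ∈ orthochronousLorentz d := by
  refine ⟨hA, fun y hy => mem_futureCone_of_minkowskiDot_pos hAx ?_ ?_⟩
  · rw [minkowskiDot_mulVec_mulVec hA]; exact hy.2
  · rw [minkowskiDot_mulVec_mulVec hA]; exact minkowskiDot_pos_of_mem hx hy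

theorem minkowskiReflection_mem_orthochronousLorentz {u : Fin (d + 1) → ℝ}
    (hu : minkowskiDot u u < 0) : minkowskiReflection u ∈ orthochronousLorentz d := by
  have h1 : minkowskiAdj (minkowskiReflection u) * minkowskiReflection u = 1 := by
    rw [minkowskiAdj_minkowskiReflection, minkowskiReflection_mul_self hu.ne]
  refine ⟨h1, fun x hx => mem_futureCone_of_minkowskiDot_pos hx ?_ ?_⟩
  · rw [minkowskiDot_mulVec_mulVec h1]; exact hx.2
  · rw [minkowskiReflection_mulVec, minkowskiDot_sub_right, minkowskiDot_smul_right,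
      minkowskiDot_comm x u]
    have : 2 / minkowskiDot u u * minkowskiDot u x * minkowskiDot u x ≤ 0 := by
      rw [mul_assoc]
      exact mul_nonpos_of_nonpos_of_nonneg (div_nonpos_of_nonneg_of_nonpos (by norm_num) hu.le)
        (mul_self_nonneg _)
    linarith [hx.2]

/-- Up to the sign of `v`, which does not affect the reflection, `u · v ≤ 0`, and then the segment
from `u` to `v` consists of spacelike vectors. -/
theorem joinedIn_minkowskiReflection {u v : Fin (d + 1) → ℝ} (hu : minkowskiDot u u < 0)
    (hv : minkowskiDot v v < 0) :
    JoinedIn (orthochronousLorentz d) (minkowskiReflection u) (minkowskiReflection v) := by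
  wlog huv : minkowskiDot u v ≤ 0 generalizing v
  · rw [← minkowskiReflection_neg v]
    refine this ?_ ?_
    · rwa [minkowskiDot_neg_left, minkowskiDot_neg_right, neg_neg]
    · rw [minkowskiDot_neg_right]; linarith
  set w : ℝ → Fin (d + 1) → ℝ := fun t => (1 - t) • u + t • v with hw
  have hwneg : ∀ t ∈ unitInterval, minkowskiDot (w t) (w t) < 0 := fun t ht => by
    rw [hw, minkowskiDot_self_add]
    simp only [minkowskiDot_smul_left, minkowskiDot_smul_right]
    have h1 : 0 ≤ 1 - t := by linarith [ht.2]
    have h2 : (1 - t) * (t * minkowskiDot u v) ≤ 0 :=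
      mul_nonpos_of_nonneg_of_nonpos h1 (mul_nonpos_of_nonneg_of_nonpos ht.1 huv)
    rcases ht.1.eq_or_lt with h | h
    · subst h; simpa using hu
    · have h3 : t * (t * minkowskiDot v v) < 0 := mul_neg_of_pos_of_neg h
        (mul_neg_of_pos_of_neg h hv)
      have h4 : (1 - t) * ((1 - t) * minkowskiDot u u) ≤ 0 :=
        mul_nonpos_of_nonneg_of_nonpos h1 (mul_nonpos_of_nonneg_of_nonpos h1 hu.le)
      linarith
  refine JoinedIn.ofLine (f := fun t => minkowskiReflection (w t)) ?_ ?_ ?_ ?_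
  · have c1 : Continuous w := by fun_prop
    have c2 : ContinuousOn (fun t => 2 / minkowskiDot (w t) (w t)) unitInterval :=
      continuousOn_const.div (continuous_minkowskiDot c1 c1).continuousOn
        fun t ht => (hwneg t ht).ne
    have c3 : Continuous fun t =>
        Matrix.vecMulVec (w t) (minkowskiMetric ℝ d *ᵥ w t) := by fun_prop
    exact continuousOn_const.sub (c2.smul c3.continuousOn)
  · simp [hw]
  · simp [hw]
  · rintro _ ⟨t, ht, rfl⟩
    exact minkowskiReflection_mem_orthochronousLorentz (hwneg t ht)

/-- Multiplying by spacelike reflections, an orthochronous Lorentz matrix is made to fix the basis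
vectors one after the other; since spacelike reflections are joined to one another, it is joined
to the identity or to a reflection, according to its determinant. -/
theorem joinedIn_one_or_reflection (n : ℕ) : ∀ A ∈ orthochronousLorentz d,
    (∀ j : Fin (d + 1), (j : ℕ) + n < d + 1 → A *ᵥ Pi.single j 1 = Pi.single j 1) →
    (JoinedIn (orthochronousLorentz d) A 1 ∧ A.det = 1) ∨
      ∃ u, minkowskiDot u u < 0 ∧
        JoinedIn (orthochronousLorentz d) A (minkowskiReflection u) ∧ A.det = -1 := by
  induction n with
  | zero =>
    intro A hA hfix
    have : A = 1 := Matrix.ext_of_mulVec_single fun i => by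
      rw [hfix i i.2, Matrix.one_mulVec]
    subst this
    exact Or.inl ⟨JoinedIn.refl hA, Matrix.det_one⟩
  | succ n ih =>
    intro A hA hfix
    by_cases hn : d + 1 ≤ n
    · exact ih A hA fun j hj => by omega
    set k : Fin (d + 1) := ⟨d - n, by omega⟩ with hk
    set e : Fin (d + 1) → ℝ := Pi.single k 1 with he
    have hstep : ∀ B ∈ orthochronousLorentz d,
        (∀ j : Fin (d + 1), (j : ℕ) < d - n → B *ᵥ Pi.single j 1 = Pi.single j 1) →
        B *ᵥ e = e →
        (∀ j : Fin (d + 1), (j : ℕ) + n < d + 1 → B *ᵥ Pi.single j 1 = Pi.single j 1) := by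
      intro B _ h1 h2 j hj
      rcases Nat.lt_or_ge j (d - n) with h | h
      · exact h1 j h
      · have : j = k := Fin.ext (by simp only [hk]; omega)
        rw [this]; exact h2
    have hfix' : ∀ j : Fin (d + 1), (j : ℕ) < d - n → A *ᵥ Pi.single j 1 = Pi.single j 1 :=
      fun j hj => hfix j (by omega)
    set u := e - A *ᵥ e with hu
    by_cases hu0 : u = 0
    · exact ih A hA (hstep A hA hfix' (sub_eq_zero.mp hu0).symm)
    have horth : ∀ j : Fin (d + 1), (j : ℕ) < d - n → minkowskiDot u (Pi.single j 1) = 0 := by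
      intro j hj
      rw [hu, minkowskiDot_sub_left]
      conv_lhs => rw [← hfix' j hj]
      rw [minkowskiDot_mulVec_mulVec hA.1, hfix' j hj, sub_self]
    have huu : minkowskiDot u u
        = 2 * (minkowskiDot e e - minkowskiDot e (A *ᵥ e)) := by
      rw [hu, minkowskiDot_sub_left, minkowskiDot_sub_right, minkowskiDot_sub_right,
        minkowskiDot_mulVec_mulVec hA.1, minkowskiDot_comm (A *ᵥ e)]
      ring
    have hneg : minkowskiDot u u < 0 := by
      have h0 : (Pi.single 0 1 : Fin (d + 1) → ℝ) ∈ futureCone d := timeAxis_mem_futureCone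
      rcases Nat.eq_zero_or_pos (d - n) with h | h
      · -- here `e` is the time axis, and `e · A e` is at least `1`
        have hke : e = Pi.single 0 1 := by
          rw [he]; congr 1; exact Fin.ext (by simpa [hk] using h)
        rw [← hke] at h0
        have h1 := hA.2 e h0
        have h2 : minkowskiDot (A *ᵥ e) (A *ᵥ e) = 1 := by
          rw [minkowskiDot_mulVec_mulVec hA.1, hke]; simp [minkowskiDot]
        have h3 : minkowskiDot e (A *ᵥ e) = (A *ᵥ e) 0 := by
          rw [hke]; simp [minkowskiDot]
        have h4 : minkowskiDot e e = 1 := by rw [hke]; simp [minkowskiDot]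
        have h5 : 1 ≤ (A *ᵥ e) 0 := by
          have := minkowskiDot_self_le (A *ᵥ e)
          rw [h2] at this
          nlinarith [h1.1]
        by_contra! hge
        have h6 : minkowskiDot e u = 0 := by
          rw [hu, minkowskiDot_sub_right]; linarith
        exact absurd (minkowskiDot_self_neg_of_orthogonal h0.2 h6 hu0) (not_lt.mpr hge)
      · refine minkowskiDot_self_neg_of_orthogonal h0.2 ?_ hu0
        rw [minkowskiDot_comm]
        exact horth 0 (by simpa using h)
    set r := minkowskiReflection u with hr
    have hrmem : r ∈ orthochronousLorentz d := minkowskiReflection_mem_orthochronousLorentz hneg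
    have hrr : r * r = 1 := minkowskiReflection_mul_self hneg.ne
    have hB : r * A ∈ orthochronousLorentz d := mul_mem_orthochronousLorentz hrmem hA
    have hA' : A = r * (r * A) := by rw [← mul_assoc, hrr, one_mul]
    have hdet : A.det = - (r * A).det := by
      rw [Matrix.det_mul, det_minkowskiReflection hneg.ne]; ring
    have hBfix := ih (r * A) hB <| hstep (r * A) hB
      (fun j hj => by
        rw [← Matrix.mulVec_mulVec, hfix' j hj, hr, minkowskiReflection_mulVec, horth j hj]
        simp)
      (by
        have h1 : minkowskiDot u (A *ᵥ e) = - (minkowskiDot u u / 2) := by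
          rw [huu, hu, minkowskiDot_sub_left, minkowskiDot_mulVec_mulVec hA.1]; ring
        rw [← Matrix.mulVec_mulVec, hr, minkowskiReflection_mulVec, h1]
        have h2 : 2 / minkowskiDot u u * -(minkowskiDot u u / 2) = -1 := by
          field_simp [hneg.ne]
        rw [h2, hu]
        module)
    have hmul : ∀ {X : Matrix (Fin (d + 1)) (Fin (d + 1)) ℝ},
        JoinedIn (orthochronousLorentz d) (r * A) X →
          JoinedIn (orthochronousLorentz d) A (r * X) := by
      rintro X ⟨γ, hγ⟩
      rw [hA']
      exact ⟨γ.map (f := fun Y => r * Y) (by fun_prop),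
        fun t => mul_mem_orthochronousLorentz hrmem (hγ t)⟩
    rcases hBfix with ⟨h1, h2⟩ | ⟨v, hv, h1, h2⟩
    · refine Or.inr ⟨u, hneg, ?_, by rw [hdet, h2]⟩
      simpa using hmul h1
    · refine Or.inl ⟨?_, by rw [hdet, h2, neg_neg]⟩
      rw [← hrr]
      exact hmul (h1.trans (joinedIn_minkowskiReflection hv hneg))

/-- The restricted real Lorentz group is path connected. -/
theorem joinedIn_orthochronousLorentz_one {A : Matrix (Fin (d + 1)) (Fin (d + 1)) ℝ}
    (hA : A ∈ orthochronousLorentz d) (hdet : A.det = 1) :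
    JoinedIn (orthochronousLorentz d ∩ {B | B.det = 1}) 1 A := by
  have h := joinedIn_one_or_reflection (d + 1) A hA fun j hj => by omega
  rcases h with ⟨h1, -⟩ | ⟨u, -, -, h2⟩
  · obtain ⟨γ, hγ⟩ := h1.symm
    refine ⟨γ, fun t => ⟨hγ t, ?_⟩⟩
    have hsq : ∀ s, (γ s).det * (γ s).det = 1 := fun s => by
      have := congrArg Matrix.det (hγ s).1
      rwa [Matrix.det_mul, det_minkowskiAdj, Matrix.det_one] at this
    rcases mul_self_eq_one_iff.mp (hsq t) with h | h
    · exact h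
    · have hc : Continuous fun s => (γ s).det := γ.continuous.matrix_det
      obtain ⟨s, hs⟩ := mem_range_of_exists_le_of_exists_ge hc ⟨t, by rw [h]; norm_num⟩
        ⟨0, by rw [γ.source, Matrix.det_one]; norm_num⟩ (c := (0 : ℝ))
      have := hsq s
      simp only at hs
      rw [hs] at this
      norm_num at this
  · rw [hdet] at h2; norm_num at h2

theorem forwardTube_mulVec {A : Matrix (Fin (d + 1)) (Fin (d + 1)) ℝ}
    (hA : A ∈ orthochronousLorentz d) {z : Fin (d + 1) → ℂ} (hz : z ∈ forwardTube d) :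
    complexify d A *ᵥ z ∈ forwardTube d := by
  rw [mem_forwardTube_iff, imVec_complexify_mulVec]
  exact hA.2 _ hz

/-- The inverse of an orthochronous Lorentz matrix is orthochronous. -/
theorem minkowskiAdj_mem_orthochronousLorentz {A : Matrix (Fin (d + 1)) (Fin (d + 1)) ℝ}
    (hA : A ∈ orthochronousLorentz d) : minkowskiAdj A ∈ orthochronousLorentz d := by
  refine mem_orthochronousLorentz_of_mem (x := A *ᵥ Pi.single 0 1) ?_
    (hA.2 _ timeAxis_mem_futureCone) ?_
  · rw [minkowskiAdj_minkowskiAdj]; exact mul_eq_one_comm.mp hA.1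
  · rw [Matrix.mulVec_mulVec, hA.1, Matrix.one_mulVec]; exact timeAxis_mem_futureCone

end RealLorentz

/-! ### The path attached to a polar decomposition -/

/-- If `M = Λ (C + iS)²` with `Λ` in the restricted real Lorentz group and `C`, `S` as in
`joinedIn_one_sq`, then `M` is joined to the identity by a path of the required kind: first from `1`
to `(C + iS)²`, then from `(C + iS)²` to `M` along a path from `1` to `Λ` in the real group. -/
theorem joinedIn_of_polar {d : ℕ} (M : complexLorentzGroup d)
    {A C S : Matrix (Fin (d + 1)) (Fin (d + 1)) ℝ} (hA : A ∈ orthochronousLorentz d)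
    (hC : minkowskiAdj C = C) (hS : minkowskiAdj S = -S) (hCS : Commute C S)
    (h1 : C * C + S * S = 1) (hdet : ∀ c ∈ Set.Icc (0 : ℝ) 1, (1 - c • (S * S)).det ≠ 0)
    (hM : M.1.1 = complexify d A * ((complexify d C + Complex.I • complexify d S)
      * (complexify d C + Complex.I • complexify d S))) :
    JoinedIn {B : complexLorentzGroup d | ∀ z ∈ forwardTube d,
      lorentzAct M z ∈ forwardTube d → lorentzAct B z ∈ forwardTube d} 1 M := by
  set U := complexify d C + Complex.I • complexify d S with hU
  have hUU : minkowskiAdj U * U = 1 := by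
    rw [hU, minkowskiAdj_mul_add_I_smul hC hS hCS, h1, map_one]
  have hUdet : (U * U).det = 1 := by
    have := congrArg Matrix.det hUU
    rwa [Matrix.det_mul, det_minkowskiAdj, Matrix.det_one, ← Matrix.det_mul] at this
  have hAdet : A.det = 1 := by
    have := M.1.2
    rw [hM, Matrix.det_mul, hUdet, mul_one, det_complexify] at this
    exact_mod_cast this
  set W : complexLorentzGroup d :=
    lorentzOfMatrix (U * U) (minkowskiAdj_mul_self_mul hUU hUU) hUdet with hW
  have hW1 : W.1.1 = U * U := rfl
  have hact : ∀ z, lorentzAct M z = complexify d A *ᵥ lorentzAct W z := fun z => by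
    rw [lorentzAct, lorentzAct, hM, hW1, Matrix.mulVec_mulVec]
  have htube : ∀ z, lorentzAct M z ∈ forwardTube d → lorentzAct W z ∈ forwardTube d := by
    intro z hz
    have := forwardTube_mulVec (minkowskiAdj_mem_orthochronousLorentz hA) hz
    rwa [hact, Matrix.mulVec_mulVec, ← map_mul, hA.1, map_one, Matrix.one_mulVec] at this
  have hj1 := joinedIn_one_sq hC hS hCS h1 hdet W hW1
  refine (hj1.mono fun B hB z hz hMz => hB z hz (htube z hMz)).trans ?_
  obtain ⟨γ, hγ⟩ := joinedIn_orthochronousLorentz_one hA hAdet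
  have hL : ∀ t, minkowskiAdj (complexify d (γ t)) * complexify d (γ t) = 1 := fun t => by
    rw [minkowskiAdj_complexify, ← map_mul, (hγ t).1.1, map_one]
  have hLdet : ∀ t, (complexify d (γ t)).det = 1 := fun t => by
    rw [det_complexify, (hγ t).2, Complex.ofReal_one]
  refine ⟨⟨⟨fun t => lorentzOfMatrix _ (hL t) (hLdet t) * W, ?_⟩, ?_, ?_⟩, ?_⟩
  · refine Continuous.mul ?_ continuous_const
    have c3 : Continuous (complexify d) :=
      continuous_matrix fun i j => Complex.continuous_ofReal.comp (continuous_apply_apply i j)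
    exact ((c3.comp γ.continuous).subtype_mk _).subtype_mk _
  · refine Subtype.ext (Subtype.ext ?_)
    change complexify d (γ 0) * (U * U) = U * U
    rw [γ.source, map_one, one_mul]
  · refine Subtype.ext (Subtype.ext ?_)
    change complexify d (γ 1) * (U * U) = M.1.1
    rw [γ.target, hM]
  · intro t z _ hMz
    change (complexify d (γ t) * (U * U)) *ᵥ z ∈ forwardTube d
    rw [← Matrix.mulVec_mulVec]
    exact forwardTube_mulVec (hγ t).1 (htube z hMz)

/-! ### Square roots of matrices with positive eigenvalues -/

section SquareRoot

open Polynomial in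
/-- Modulo a product of factors `X - a` with `a > 0`, the polynomial `X` has a square root that is
positive at each `a`. The factors are added one at a time: with `p` the product so far, `q` is
replaced by `q + c p`, and `c` is determined by the value at the new `a` that is required of the
square root or, if `a` is already a root of `p`, of the cofactor of `p`. -/
theorem exists_sq_sub_X_dvd (s : Multiset ℝ) (hs : ∀ a ∈ s, 0 < a) :
    ∃ q : ℝ[X], (s.map fun a => X - C a).prod ∣ q ^ 2 - X ∧ ∀ a ∈ s, 0 < q.eval a := by
  induction s using Multiset.induction_on with
  | empty => exact ⟨0, by simp, by simp⟩
  | cons a s ih =>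
    obtain ⟨q, ⟨r, hr⟩, hq⟩ := ih fun b hb => hs b (Multiset.mem_cons_of_mem hb)
    set p := (s.map fun a => X - C a).prod with hp
    have hproot : ∀ b ∈ s, p.eval b = 0 := fun b hb => by
      have : X - C b ∣ p := Multiset.dvd_prod (Multiset.mem_map_of_mem _ hb)
      exact dvd_iff_isRoot.mp this
    -- the common part of the two cases: a constant making the new cofactor vanish at `a`
    have main : ∀ c : ℝ, (r + 2 * C c * q + C c ^ 2 * p).eval a = 0 → 0 < (q + C c * p).eval a →
        ∃ q : ℝ[X], ((a ::ₘ s).map fun a => X - C a).prod ∣ q ^ 2 - X ∧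
          ∀ b ∈ a ::ₘ s, 0 < q.eval b := by
      intro c hc hpos
      refine ⟨q + C c * p, ?_, ?_⟩
      · rw [Multiset.map_cons, Multiset.prod_cons, ← hp]
        have h1 : (q + C c * p) ^ 2 - X = (r + 2 * C c * q + C c ^ 2 * p) * p := by
          linear_combination hr
        rw [h1]
        exact mul_dvd_mul_right (dvd_iff_isRoot.mpr hc) p
      · intro b hb
        rcases Multiset.mem_cons.mp hb with rfl | hb
        · exact hpos
        · simpa [hproot b hb] using hq b hb
    have hra : (q.eval a) ^ 2 - a = p.eval a * r.eval a := by
      simpa using congrArg (eval a) hr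
    by_cases ha : p.eval a = 0
    · have has : a ∈ s := by
        rw [hp, eval_multiset_prod, Multiset.map_map, Multiset.prod_eq_zero_iff,
          Multiset.mem_map] at ha
        obtain ⟨b, hb, hb'⟩ := ha
        have : a = b := by simpa [sub_eq_zero] using hb'
        rwa [this]
      have hqa := hq a has
      refine main (-(r.eval a) / (2 * q.eval a)) ?_ (by simpa [ha] using hqa)
      simp only [eval_add, eval_mul, eval_pow, eval_C, ha, eval_ofNat]
      field_simp
      ring
    · have hsq := Real.sq_sqrt (hs a (Multiset.mem_cons_self a s)).le
      have hval : (q + C ((√a - q.eval a) / p.eval a) * p).eval a = √a := by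
        simp only [eval_add, eval_mul, eval_C]
        field_simp
        ring
      refine main _ ?_ (by
        rw [hval]; exact Real.sqrt_pos.mpr (hs a (Multiset.mem_cons_self a s)))
      simp only [eval_add, eval_mul, eval_C] at hval
      simp only [eval_add, eval_mul, eval_pow, eval_C, eval_ofNat]
      set c := (√a - q.eval a) / p.eval a
      refine (mul_eq_zero.mp (?_ : p.eval a * _ = 0)).resolve_left ha
      rw [← hval] at hsq
      linear_combination hsq - hra

variable {m : Type*} [Fintype m] [DecidableEq m]

/-- An eigenspace of `B` contains an eigenvector of every matrix that commutes with `B`. -/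
theorem exists_common_eigenvector {A B : Matrix m m ℂ} (h : Commute A B) {v : m → ℂ} (hv : v ≠ 0)
    {b : ℂ} (hB : B *ᵥ v = b • v) :
    ∃ w, w ≠ 0 ∧ B *ᵥ w = b • w ∧ ∃ a : ℂ, A *ᵥ w = a • w := by
  set p : Submodule ℂ (m → ℂ) := LinearMap.ker (B - b • 1).mulVecLin with hp
  have hmem : ∀ x, x ∈ p ↔ B *ᵥ x = b • x := fun x => by
    rw [hp, LinearMap.mem_ker, Matrix.mulVecLin_apply, Matrix.sub_mulVec, Matrix.smul_mulVec,
      Matrix.one_mulVec, sub_eq_zero]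
  have hmaps : ∀ x ∈ p, A.mulVecLin x ∈ p := fun x hx => by
    rw [hmem] at hx ⊢
    rw [Matrix.mulVecLin_apply, Matrix.mulVec_mulVec, ← h.eq, ← Matrix.mulVec_mulVec, hx,
      Matrix.mulVec_smul]
  have : Nontrivial p := ⟨⟨⟨v, (hmem v).mpr hB⟩, 0, fun h => hv (congrArg Subtype.val h)⟩⟩
  obtain ⟨a, ha⟩ := Module.End.exists_eigenvalue (A.mulVecLin.restrict hmaps)
  obtain ⟨w, hw⟩ := ha.exists_hasEigenvector
  refine ⟨w, fun h => hw.2 (Subtype.ext h), (hmem w).mp w.2, a, ?_⟩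
  exact congrArg Subtype.val hw.apply_eq_smul

theorem aeval_mulVec_of_eigenvector {A : Matrix m m ℂ} {v : m → ℂ} {r : ℝ}
    (h : A *ᵥ v = (r : ℂ) • v) (q : Polynomial ℝ) :
    Polynomial.aeval A q *ᵥ v = ((q.eval r : ℝ) : ℂ) • v := by
  induction q using Polynomial.induction_on' with
  | add p q hp hq => rw [map_add, Matrix.add_mulVec, hp, hq, Polynomial.eval_add,
      Complex.ofReal_add, add_smul]
  | monomial n a =>
    have hpow : ∀ n : ℕ, (A ^ n) *ᵥ v = (r : ℂ) ^ n • v := fun n => by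
      induction n with
      | zero => simp
      | succ n ih => rw [pow_succ, ← Matrix.mulVec_mulVec, h, Matrix.mulVec_smul, ih, smul_smul,
          pow_succ, mul_comm]
    rw [Polynomial.aeval_monomial, Polynomial.eval_monomial, ← Algebra.smul_def,
      Matrix.smul_mulVec, hpow]
    funext i
    simp [mul_assoc]

theorem commute_aeval {A B : Matrix m m ℂ} (h : Commute A B) (q : Polynomial ℝ) :
    Commute (Polynomial.aeval A q) B := by
  induction q using Polynomial.induction_on' with
  | add p q hp hq => rw [map_add]; exact hp.add_left hq
  | monomial n a =>
    rw [Polynomial.aeval_monomial]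
    exact Commute.mul_left (Algebra.commutes a B) (h.pow_left n)

theorem minkowskiAdj_aeval {d : ℕ} (A : Matrix (Fin (d + 1)) (Fin (d + 1)) ℂ)
    (q : Polynomial ℝ) :
    minkowskiAdj (Polynomial.aeval A q) = Polynomial.aeval (minkowskiAdj A) q := by
  induction q using Polynomial.induction_on' with
  | add p q hp hq => rw [map_add, map_add, minkowskiAdj_add, hp, hq]
  | monomial n a =>
    have hpow : ∀ n : ℕ, minkowskiAdj (A ^ n) = minkowskiAdj A ^ n := fun n => by
      induction n with
      | zero => simp
      | succ n ih => rw [pow_succ, minkowskiAdj_mul, ih, pow_succ']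
    rw [Polynomial.aeval_monomial, Polynomial.aeval_monomial, ← Algebra.smul_def,
      ← Algebra.smul_def, ← hpow, ← algebraMap_smul ℂ a, ← algebraMap_smul ℂ a,
      minkowskiAdj_smul]

/-- All eigenvalues of a complex matrix are positive real numbers. -/
def PositiveEigenvalues (A : Matrix m m ℂ) : Prop :=
  ∀ (v : m → ℂ) (a : ℂ), v ≠ 0 → A *ᵥ v = a • v → ∃ r : ℝ, 0 < r ∧ a = r

/-- The matrices `U` with `Ū = U⁻¹` whose Minkowski adjoint is `U⁻¹` as well; among them are the
exponentials of `i` times real antisymmetric matrices. -/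
def IsImaginaryLorentz {d : ℕ} (U : Matrix (Fin (d + 1)) (Fin (d + 1)) ℂ) : Prop :=
  conjMatrix d U * U = 1 ∧ minkowskiAdj U = conjMatrix d U

theorem mulVec_conjMatrix_of_eigenvector {d : ℕ} {N : Matrix (Fin (d + 1)) (Fin (d + 1)) ℂ}
    (h : conjMatrix d N * N = 1) {v : Fin (d + 1) → ℂ} {a : ℂ} (hv : v ≠ 0)
    (ha : N *ᵥ v = a • v) : a ≠ 0 ∧ conjMatrix d N *ᵥ v = a⁻¹ • v := by
  have h1 : a • (conjMatrix d N *ᵥ v) = v := by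
    rw [← Matrix.mulVec_smul, ← ha, Matrix.mulVec_mulVec, h, Matrix.one_mulVec]
  have h0 : a ≠ 0 := by
    rintro rfl
    exact hv (by rw [← h1, zero_smul])
  refine ⟨h0, ?_⟩
  conv_rhs => rw [← h1, smul_smul, inv_mul_cancel₀ h0, one_smul]

/-- The principal square root of an imaginary Lorentz matrix with positive eigenvalues. It is a
real polynomial `q` in the matrix; `q(N̄)` and `q(N)` are then inverse to each other because their
product squares to `1` and has positive eigenvalues. -/
theorem IsImaginaryLorentz.exists_sqrt {d : ℕ} {N : Matrix (Fin (d + 1)) (Fin (d + 1)) ℂ}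
    (hN : IsImaginaryLorentz N) (hpos : PositiveEigenvalues N) :
    ∃ U, IsImaginaryLorentz U ∧ PositiveEigenvalues U ∧ U * U = N ∧
      ∀ v, N *ᵥ v = v → U *ᵥ v = v := by
  obtain ⟨hcj, hadj⟩ := hN
  set s : Multiset ℝ := N.charpoly.roots.map Complex.re with hs
  have hroot : ∀ a ∈ N.charpoly.roots, ∃ r : ℝ, 0 < r ∧ a = r := fun a ha => by
    have h1 := Polynomial.isRoot_of_mem_roots ha
    rw [Polynomial.IsRoot, Matrix.eval_charpoly] at h1
    obtain ⟨v, hv, hv'⟩ := Matrix.exists_mulVec_eq_zero_iff.mpr h1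
    refine hpos v a hv ?_
    rw [Matrix.sub_mulVec, sub_eq_zero] at hv'
    rw [← hv']
    funext i
    simp [Matrix.mulVec_diagonal]
  have hspos : ∀ a ∈ s, 0 < a := fun a ha => by
    obtain ⟨b, hb, rfl⟩ := Multiset.mem_map.mp ha
    obtain ⟨r, hr, rfl⟩ := hroot b hb
    simpa using hr
  set p : Polynomial ℝ := (s.map fun a => Polynomial.X - Polynomial.C a).prod with hp
  have hpmap : p.map (algebraMap ℝ ℂ) = N.charpoly := by
    rw [(IsAlgClosed.splits N.charpoly).eq_prod_roots, (Matrix.charpoly_monic N).leadingCoeff,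
      Polynomial.C_1, one_mul, hp, Polynomial.map_multiset_prod, hs, Multiset.map_map,
      Multiset.map_map]
    congr 1
    refine Multiset.map_congr rfl fun a ha => ?_
    obtain ⟨r, -, rfl⟩ := hroot a ha
    simp
  have hpN : Polynomial.aeval N p = 0 := by
    rw [← Polynomial.aeval_map_algebraMap ℂ, hpmap, Matrix.aeval_self_charpoly]
  obtain ⟨q, ⟨r, hr⟩, hq⟩ := exists_sq_sub_X_dvd s hspos
  rw [← hp] at hr
  set U := Polynomial.aeval N q with hU
  have hUU : U * U = N := by
    have := congrArg (Polynomial.aeval N) hr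
    rw [map_mul, hpN, zero_mul, map_sub, map_pow, Polynomial.aeval_X, sub_eq_zero, sq] at this
    exact this
  have heig : ∀ (v : Fin (d + 1) → ℂ) (a : ℂ), v ≠ 0 → N *ᵥ v = a • v →
      ∃ r : ℝ, 0 < r ∧ a = r ∧ 0 < q.eval r ∧ U *ᵥ v = ((q.eval r : ℝ) : ℂ) • v := by
    intro v a hv ha
    obtain ⟨r, hr, rfl⟩ := hpos v a hv ha
    refine ⟨r, hr, rfl, hq r ?_, aeval_mulVec_of_eigenvector ha q⟩
    have h1 := aeval_mulVec_of_eigenvector ha p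
    rw [hpN, Matrix.zero_mulVec, eq_comm, smul_eq_zero_iff_left hv, Complex.ofReal_eq_zero, hp,
      Polynomial.eval_multiset_prod, Multiset.map_map, Multiset.prod_eq_zero_iff,
      Multiset.mem_map] at h1
    obtain ⟨b, hb, hb'⟩ := h1
    have : r = b := by simpa [sub_eq_zero] using hb'
    rwa [this]
  have hcjU : conjMatrix d U = Polynomial.aeval (conjMatrix d N) q :=
    (Polynomial.aeval_algHom_apply (conjMatrix d) N q).symm
  have hNN : Commute N (conjMatrix d N) := by
    rw [commute_iff_eq, hcj, mul_eq_one_comm.mp hcj]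
  have hc1 : Commute U (conjMatrix d N) := commute_aeval hNN q
  have hc2 : Commute (conjMatrix d U) U := by
    rw [hcjU]; exact commute_aeval hc1.symm q
  have hNU : Commute N U := (commute_aeval (Commute.refl N) q).symm
  have hNcU : Commute N (conjMatrix d U) := by
    rw [hcjU]; exact (commute_aeval hNN.symm q).symm
  refine ⟨U, ⟨?_, ?_⟩, ?_, hUU, ?_⟩
  · set Y := conjMatrix d U * U with hY
    have hYY : Y * Y = 1 := by
      rw [hY, hc2.symm.mul_mul_mul_comm, ← map_mul, hUU, hcj]
    by_contra hne
    have h1 : Y - 1 ≠ 0 := sub_ne_zero.mpr hne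
    obtain ⟨x, hx⟩ : ∃ x, (Y - 1) *ᵥ x ≠ 0 := by
      by_contra! h
      exact h1 (Matrix.ext_of_mulVec_single fun i => by rw [h, Matrix.zero_mulVec])
    have h2 : Y *ᵥ ((Y - 1) *ᵥ x) = (-1 : ℂ) • ((Y - 1) *ᵥ x) := by
      rw [Matrix.mulVec_mulVec, mul_sub, hYY, mul_one, ← Matrix.smul_mulVec]
      congr 1
      module
    obtain ⟨w, hw, hYw, a, ha⟩ := exists_common_eigenvector (hNcU.mul_right hNU) hx h2
    obtain ⟨r, hr, rfl, hqr, hUw⟩ := heig w a hw ha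
    have h3 := (mulVec_conjMatrix_of_eigenvector hcj hw ha).2
    have h4 : N *ᵥ star w = ((r⁻¹ : ℝ) : ℂ) • star w := by
      rw [← conjMatrix_conjMatrix N, conjMatrix_mulVec, h3, star_smul]
      simp
    obtain ⟨r', -, hr', hqr', -⟩ := heig _ _ (star_ne_zero.mpr hw) h4
    have h5 : r' = r⁻¹ := by exact_mod_cast hr'.symm
    rw [h5] at hqr'
    have h6 : conjMatrix d U *ᵥ w = ((q.eval r⁻¹ : ℝ) : ℂ) • w := by
      rw [hcjU]
      refine aeval_mulVec_of_eigenvector ?_ q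
      rw [h3]; simp
    rw [← Matrix.mulVec_mulVec, hUw, Matrix.mulVec_smul, h6, smul_smul] at hYw
    have h7 := smul_left_injective ℂ hw hYw
    have h8 : q.eval r * q.eval r⁻¹ = -1 := by exact_mod_cast h7
    nlinarith [mul_pos hqr hqr']
  · rw [hU, minkowskiAdj_aeval, hadj, ← hU, hcjU]
  · intro v u hv hu
    obtain ⟨w, hw, hUw, a, ha⟩ := exists_common_eigenvector hNU hv hu
    obtain ⟨r, hr, rfl, hqr, hUw'⟩ := heig w a hw ha
    exact ⟨_, hqr, smul_left_injective ℂ hw (hUw.symm.trans hUw')⟩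
  · intro v hv
    rcases eq_or_ne v 0 with rfl | hv0
    · simp
    obtain ⟨r, hr, hr1, hqr, hUv⟩ := heig v 1 hv0 (by rw [hv, one_smul])
    have h1 : U *ᵥ (U *ᵥ v) = v := by rw [Matrix.mulVec_mulVec, hUU, hv]
    rw [hUv, Matrix.mulVec_smul, hUv, smul_smul] at h1
    have h2 : ((q.eval r : ℝ) : ℂ) * ((q.eval r : ℝ) : ℂ) = 1 :=
      smul_left_injective ℂ hv0 (by simpa using h1)
    have h3 : q.eval r * q.eval r = 1 := by exact_mod_cast h2
    have h4 : q.eval r = 1 := by nlinarith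
    rw [hUv, h4]; simp

/-- An imaginary Lorentz matrix is `C + iS`, the sum of its cosine and `i` times its sine. -/
theorem IsImaginaryLorentz.exists_cos_sin {d : ℕ} {U : Matrix (Fin (d + 1)) (Fin (d + 1)) ℂ}
    (hU : IsImaginaryLorentz U) :
    ∃ C S : Matrix (Fin (d + 1)) (Fin (d + 1)) ℝ,
      complexify d C + Complex.I • complexify d S = U ∧ minkowskiAdj C = C ∧
      minkowskiAdj S = -S ∧ Commute C S ∧ C * C + S * S = 1 ∧
      complexify d S = (2 * Complex.I)⁻¹ • (U - conjMatrix d U) := by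
  obtain ⟨hcj, hadj⟩ := hU
  set V := conjMatrix d U with hV
  have hVc : conjMatrix d V = U := conjMatrix_conjMatrix U
  have hadjV : minkowskiAdj V = U := by rw [← hadj, minkowskiAdj_minkowskiAdj]
  have hcj' : U * V = 1 := mul_eq_one_comm.mp hcj
  obtain ⟨C, hC⟩ := exists_complexify_eq (A := (2 : ℂ)⁻¹ • (U + V)) (by
    rw [conjMatrix_smul, map_add, ← hV, hVc, add_comm V, map_inv₀, map_ofNat])
  obtain ⟨S, hS⟩ := exists_complexify_eq (A := (2 * Complex.I)⁻¹ • (U - V)) (by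
    rw [conjMatrix_smul, map_sub, ← hV, hVc]
    simp only [map_inv₀, map_mul, Complex.conj_I, map_ofNat]
    match_scalars <;> field_simp)
  have hI : Complex.I * (2 * Complex.I)⁻¹ = 2⁻¹ := by field_simp
  have hUV : complexify d C + Complex.I • complexify d S = U := by
    rw [hC, hS, smul_smul, hI]
    module
  have hcomm : Commute C S := by
    refine complexify_injective ?_
    rw [map_mul, map_mul, hC, hS]
    simp only [Matrix.smul_mul, Matrix.mul_smul, add_mul, mul_sub, sub_mul, mul_add, hcj, hcj']
    module
  have hCa : minkowskiAdj C = C := by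
    refine complexify_injective ?_
    rw [← minkowskiAdj_complexify, hC, minkowskiAdj_smul, minkowskiAdj_add, hadj, hadjV,
      add_comm V]
  have hSa : minkowskiAdj S = -S := by
    refine complexify_injective ?_
    rw [← minkowskiAdj_complexify, hS, minkowskiAdj_smul, minkowskiAdj_sub, hadj, hadjV, map_neg,
      hS]
    module
  refine ⟨C, S, hUV, hCa, hSa, hcomm, ?_, hS⟩
  refine complexify_injective ?_
  rw [← minkowskiAdj_mul_add_I_smul hCa hSa hcomm, hUV, hadj, hcj, map_one]

/-- For `u > 0` an eigenvalue of `U`, the square of `S = (U - U⁻¹)/(2i)` has eigenvalue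
`-(u - u⁻¹)²/4 ≤ 0`. -/
theorem IsImaginaryLorentz.det_one_sub_smul_ne_zero {d : ℕ}
    {U : Matrix (Fin (d + 1)) (Fin (d + 1)) ℂ} (hU : IsImaginaryLorentz U)
    (hpos : PositiveEigenvalues U) {S : Matrix (Fin (d + 1)) (Fin (d + 1)) ℝ}
    (hS : complexify d S = (2 * Complex.I)⁻¹ • (U - conjMatrix d U)) {c : ℝ} (hc : 0 ≤ c) :
    (1 - c • (S * S)).det ≠ 0 := by
  intro hdet
  have h1 : (complexify d (1 - c • (S * S))).det = 0 := by rw [det_complexify, hdet]; rfl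
  obtain ⟨v, hv, hv'⟩ := Matrix.exists_mulVec_eq_zero_iff.mpr h1
  have hUV : Commute U (conjMatrix d U) := by
    rw [commute_iff_eq, hU.1, mul_eq_one_comm.mp hU.1]
  have hUS : Commute U (complexify d S) := by
    rw [hS]; exact ((Commute.refl U).sub_right hUV).smul_right _
  have hcomm : Commute U (complexify d (1 - c • (S * S))) := by
    rw [map_sub, map_one, map_smul, map_mul]
    exact (Commute.one_right U).sub_right ((hUS.mul_right hUS).smul_right c)
  obtain ⟨w, hw, hw0, u, hu⟩ := exists_common_eigenvector hcomm hv
    (show _ = (0 : ℂ) • v by rw [hv', zero_smul])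
  obtain ⟨r, hr, rfl⟩ := hpos w u hw hu
  have h2 := (mulVec_conjMatrix_of_eigenvector hU.1 hw hu).2
  have h3 : complexify d S *ᵥ w = ((2 * Complex.I)⁻¹ * (r - (r : ℂ)⁻¹)) • w := by
    rw [hS, Matrix.smul_mulVec, Matrix.sub_mulVec, hu, h2]
    module
  have h4 : complexify d (c • (S * S)) = (c : ℂ) • (complexify d S * complexify d S) := by
    rw [map_smul, map_mul]
    ext i j; simp
  rw [map_sub, map_one, h4, Matrix.sub_mulVec, Matrix.one_mulVec, Matrix.smul_mulVec,
    ← Matrix.mulVec_mulVec, h3, Matrix.mulVec_smul, h3, smul_smul, smul_smul, zero_smul] at hw0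
  have h5 : (1 - (c : ℂ) * ((2 * Complex.I)⁻¹ * (r - (r : ℂ)⁻¹)
      * ((2 * Complex.I)⁻¹ * (r - (r : ℂ)⁻¹)))) • w = 0 := by
    rw [sub_smul, one_smul]
    simpa only [mul_assoc] using hw0
  have h6 := (smul_eq_zero_iff_left hw).mp h5
  have h7 : ((2 * Complex.I)⁻¹ * (2 * Complex.I)⁻¹ : ℂ) = -(1 / 4) := by
    rw [← mul_inv]
    have : (2 * Complex.I * (2 * Complex.I) : ℂ) = -4 := by
      linear_combination 4 * Complex.I_mul_I
    rw [this]; norm_num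
  have h8 : (1 + (c : ℂ) * (1 / 4) * (r - (r : ℂ)⁻¹) ^ 2) = 0 := by
    linear_combination h6 + (c : ℂ) * (r - (r : ℂ)⁻¹) ^ 2 * h7
  have h9 : 1 + c * (1 / 4) * (r - r⁻¹) ^ 2 = 0 := by
    rw [← Complex.ofReal_eq_zero]
    push_cast
    exact h8
  have : 0 ≤ c * (1 / 4) * (r - r⁻¹) ^ 2 := by positivity
  linarith

end SquareRoot

/-! ### Polar decomposition when the eigenvalues are positive -/

section Positive

variable {d : ℕ}

/-- The decomposition `M = Λ (C + iS)²`, with `Λ` real Lorentz and orthochronous, from which the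
path is built. It stands for `M = Λ e^{2iX}` with `X` real and antisymmetric, `C = cos X` and
`S = sin X`; the condition on determinants says that `S` has no real eigenvalue of modulus at least
`1`. -/
def HasPolarDecomposition (M : Matrix (Fin (d + 1)) (Fin (d + 1)) ℂ) : Prop :=
  ∃ A C S : Matrix (Fin (d + 1)) (Fin (d + 1)) ℝ, A ∈ orthochronousLorentz d ∧
    minkowskiAdj C = C ∧ minkowskiAdj S = -S ∧ Commute C S ∧ C * C + S * S = 1 ∧
    (∀ c ∈ Set.Icc (0 : ℝ) 1, (1 - c • (S * S)).det ≠ 0) ∧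
    M = complexify d A * ((complexify d C + Complex.I • complexify d S)
      * (complexify d C + Complex.I • complexify d S))

/-- For a complex Lorentz matrix `M`, the matrix `M̄⁻¹ M`, which measures how far `M` is from being
real. -/
noncomputable def realityDefect (M : Matrix (Fin (d + 1)) (Fin (d + 1)) ℂ) :
    Matrix (Fin (d + 1)) (Fin (d + 1)) ℂ :=
  conjMatrix d (minkowskiAdj M) * M

variable {M : Matrix (Fin (d + 1)) (Fin (d + 1)) ℂ}

theorem conjMatrix_mul_realityDefect (hM : minkowskiAdj M * M = 1) :
    conjMatrix d M * realityDefect M = M := by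
  rw [realityDefect, ← mul_assoc, ← map_mul, mul_eq_one_comm.mp hM, map_one, one_mul]

theorem isImaginaryLorentz_realityDefect (hM : minkowskiAdj M * M = 1) :
    IsImaginaryLorentz (realityDefect M) := by
  have h : conjMatrix d (realityDefect M) = minkowskiAdj M * conjMatrix d M := by
    rw [realityDefect, map_mul, conjMatrix_conjMatrix]
  refine ⟨?_, ?_⟩
  · rw [h, mul_assoc, conjMatrix_mul_realityDefect hM, hM]
  · rw [h, realityDefect, minkowskiAdj_mul, minkowskiAdj_conjMatrix, minkowskiAdj_minkowskiAdj]

theorem realityDefect_mulVec_ofRealVec {M : Matrix (Fin (d + 1)) (Fin (d + 1)) ℂ}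
    (hM : minkowskiAdj M * M = 1) {x y : Fin (d + 1) → ℝ} (h : M *ᵥ ofRealVec x = ofRealVec y) :
    realityDefect M *ᵥ ofRealVec x = ofRealVec x := by
  have h1 : conjMatrix d M *ᵥ ofRealVec x = ofRealVec y := by
    rw [← star_ofRealVec, conjMatrix_mulVec, h, star_ofRealVec]
  rw [realityDefect, ← Matrix.mulVec_mulVec, h, ← h1, Matrix.mulVec_mulVec, ← map_mul, hM, map_one,
    Matrix.one_mulVec]

theorem exists_fourth_root (hM : minkowskiAdj M * M = 1)
    (hpos : PositiveEigenvalues (realityDefect M)) :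
    ∃ U, IsImaginaryLorentz U ∧ PositiveEigenvalues U ∧ (U * U) * (U * U) = realityDefect M ∧
      ∀ v, realityDefect M *ᵥ v = v → U *ᵥ v = v := by
  obtain ⟨V, hV, hVpos, hVV, hVfix⟩ := (isImaginaryLorentz_realityDefect hM).exists_sqrt hpos
  obtain ⟨U, hU, hUpos, hUU, hUfix⟩ := hV.exists_sqrt hVpos
  exact ⟨U, hU, hUpos, by rw [hUU, hVV], fun v hv => hUfix v (hVfix v hv)⟩

/-- Dividing `M` by a square root of `M̄⁻¹ M` leaves a real matrix. -/
theorem exists_real_factor (hM : minkowskiAdj M * M = 1)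
    {U : Matrix (Fin (d + 1)) (Fin (d + 1)) ℂ} (hU : IsImaginaryLorentz U)
    (hUU : (U * U) * (U * U) = realityDefect M) :
    ∃ A : Matrix (Fin (d + 1)) (Fin (d + 1)) ℝ, minkowskiAdj A * A = 1 ∧
      complexify d A * (U * U) = M := by
  obtain ⟨hcj, hadj⟩ := hU
  have hMcj := conjMatrix_mul_realityDefect hM
  set V := conjMatrix d U with hV
  have hUV : U * V = 1 := mul_eq_one_comm.mp hcj
  have hVc : conjMatrix d V = U := conjMatrix_conjMatrix U
  have hUV4 : (U * U) * (V * V) = 1 := by rw [mul_assoc, ← mul_assoc U V, hUV, one_mul, hUV]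
  obtain ⟨A, hA⟩ := exists_complexify_eq (A := M * (V * V)) (by
    rw [map_mul, map_mul, hVc]
    conv_rhs => rw [← hMcj, ← hUU]
    rw [mul_assoc, mul_assoc (U * U), hUV4, mul_one])
  have hmul : complexify d A * (U * U) = M := by
    rw [hA, mul_assoc, mul_eq_one_comm.mp hUV4, mul_one]
  refine ⟨A, complexify_injective ?_, hmul⟩
  have hVadj : minkowskiAdj V = U := by rw [← hadj, minkowskiAdj_minkowskiAdj]
  have hVV : minkowskiAdj V * V = 1 := by rw [hVadj, hUV]
  rw [map_mul, ← minkowskiAdj_complexify, hA, map_one]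
  exact minkowskiAdj_mul_self_mul hM (minkowskiAdj_mul_self_mul hVV hVV)

/-- An antisymmetric real matrix `S` without real eigenvalues other than `0` kills some causal
vector. On the section `x⁰ = 1` of the closed cone, `f x = -(S x)²` is nonnegative. At a zero of `f`
the null vector `S x` is orthogonal, hence proportional, to `x`. If `f` has no zero, a maximum point
`n` of `x² / f x` lies in the open cone, where `x² - r f x` is critical, and `S² n = r⁻¹ n`. -/
theorem exists_causal_mulVec_eq_zero {S : Matrix (Fin (d + 1)) (Fin (d + 1)) ℝ}
    (hS : minkowskiAdj S = -S) (hdet : ∀ c : ℝ, 0 ≤ c → (1 - c • (S * S)).det ≠ 0) :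
    ∃ n : Fin (d + 1) → ℝ, n ≠ 0 ∧ 0 ≤ n 0 ∧ 0 ≤ minkowskiDot n n ∧ S *ᵥ n = 0 := by
  have hker : ∀ c : ℝ, 0 ≤ c → ∀ x, (1 - c • (S * S)) *ᵥ x = 0 → x = 0 := fun c hc x hx => by
    by_contra hne
    exact hdet c hc (Matrix.exists_mulVec_eq_zero_iff.mp ⟨x, hne, hx⟩)
  set K : Set (Fin (d + 1) → ℝ) := {x | x 0 = 1 ∧ 0 ≤ minkowskiDot x x} with hK
  set f : (Fin (d + 1) → ℝ) → ℝ := fun x => - minkowskiDot (S *ᵥ x) (S *ᵥ x) with hf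
  have hfc : Continuous f := by
    have : Continuous fun x : Fin (d + 1) → ℝ => S *ᵥ x := by fun_prop
    exact (continuous_minkowskiDot this this).neg
  have hKne : ∀ x ∈ K, x ≠ 0 := by
    rintro x ⟨hx, -⟩ rfl
    simp at hx
  have hKc : IsCompact K := by
    have hbox := isCompact_univ_pi fun _ : Fin (d + 1) => isCompact_Icc (a := (-1 : ℝ)) (b := 1)
    refine hbox.of_isClosed_subset ((isClosed_eq (continuous_apply 0) continuous_const).inter
        (isClosed_le continuous_const (continuous_minkowskiDot continuous_id continuous_id))) ?_
    rintro x ⟨hx0, hx⟩ i -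
    refine abs_le.mp ?_
    refine Fin.cases (by rw [hx0]; simp) (fun j => ?_) i
    have h1 : x j.succ * x j.succ ≤ ∑ i : Fin d, x i.succ * x i.succ :=
      Finset.single_le_sum (f := fun i : Fin d => x i.succ * x i.succ)
        (fun i _ => mul_self_nonneg _) (Finset.mem_univ j)
    simp only [minkowskiDot, hx0] at hx
    rw [abs_le_one_iff_mul_self_le_one]
    linarith
  have hfnn : ∀ x ∈ K, 0 ≤ f x := fun x hx => by
    have := minkowskiDot_self_nonpos_of_orthogonal (hKne x hx) hx.2 (minkowskiDot_self_mulVec hS x)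
    simp only [hf]; linarith
  by_cases hex : ∃ x ∈ K, f x = 0
  · obtain ⟨x, hx, hfx⟩ := hex
    refine ⟨x, hKne x hx, by rw [hx.1]; norm_num, hx.2, ?_⟩
    obtain ⟨c, hc⟩ := exists_smul_of_minkowskiDot_eq_zero (hKne x hx) hx.2
      (minkowskiDot_self_mulVec hS x) (by simp only [hf] at hfx; linarith)
    rcases eq_or_ne c 0 with rfl | hc0
    · rw [hc, zero_smul]
    · refine absurd (hker ((c * c)⁻¹) (inv_nonneg.mpr (mul_self_nonneg c)) x ?_) (hKne x hx)
      rw [Matrix.sub_mulVec, Matrix.one_mulVec, Matrix.smul_mulVec, ← Matrix.mulVec_mulVec, hc,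
        Matrix.mulVec_smul, hc, smul_smul, smul_smul, mul_assoc,
        inv_mul_cancel₀ (mul_ne_zero hc0 hc0),
        one_smul, sub_self]
  · exfalso
    have hfpos : ∀ x ∈ K, 0 < f x := fun x hx =>
      lt_of_le_of_ne (hfnn x hx) fun h => hex ⟨x, hx, h.symm⟩
    have hK0 : (Pi.single 0 1 : Fin (d + 1) → ℝ) ∈ K :=
      ⟨by simp, timeAxis_mem_futureCone.2.le⟩
    have hgc : ContinuousOn (fun x => minkowskiDot x x / f x) K :=
      (continuous_minkowskiDot continuous_id continuous_id).continuousOn.div hfc.continuousOn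
        fun x hx => (hfpos x hx).ne'
    obtain ⟨n, hn, hmax⟩ := hKc.exists_isMaxOn ⟨_, hK0⟩ hgc
    set r := minkowskiDot n n / f n with hr
    have hrpos : 0 < r := lt_of_lt_of_le
      (div_pos timeAxis_mem_futureCone.2 (hfpos _ hK0)) (hmax hK0)
    have hnn : minkowskiDot n n = r * f n := by
      rw [hr, div_mul_cancel₀ _ (hfpos n hn).ne']
    have hnmem : n ∈ futureCone d :=
      ⟨by rw [hn.1]; norm_num, by rw [hnn]; exact mul_pos hrpos (hfpos n hn)⟩
    set T := (1 - r • (S * S)) with hT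
    have hTf : ∀ x, minkowskiDot x (T *ᵥ x) = minkowskiDot x x - r * f x := fun x => by
      rw [hT, Matrix.sub_mulVec, Matrix.one_mulVec, Matrix.smul_mulVec, ← Matrix.mulVec_mulVec,
        minkowskiDot_sub_right, minkowskiDot_smul_right, minkowskiDot_mulVec_skew hS]
    have hTadj : minkowskiAdj T = T := by
      rw [hT, minkowskiAdj_sub, minkowskiAdj_one, minkowskiAdj_smul, minkowskiAdj_mul, hS,
        neg_mul_neg]
    have hle : ∀ x ∈ futureCone d, minkowskiDot x (T *ᵥ x) ≤ 0 := fun x hx => by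
      set y := (x 0)⁻¹ • x with hy
      have hx0 := hx.1
      have hyK : y ∈ K := by
        refine ⟨by simp [hy, hx0.ne'], ?_⟩
        exact (smul_mem_futureCone (inv_pos.mpr hx0) hx).2.le
      have h1 : minkowskiDot y y / f y ≤ r := hmax hyK
      rw [div_le_iff₀ (hfpos y hyK)] at h1
      have h2 : x = x 0 • y := by rw [hy, smul_smul, mul_inv_cancel₀ hx0.ne', one_smul]
      rw [h2, Matrix.mulVec_smul, minkowskiDot_smul_left, minkowskiDot_smul_right, hTf, ← mul_assoc]
      exact mul_nonpos_of_nonneg_of_nonpos (mul_self_nonneg _) (by linarith)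
    have hTn : T *ᵥ n = 0 := by
      refine eq_of_forall_minkowskiDot fun y => ?_
      rw [minkowskiDot_zero_right]
      -- the quadratic form of `T` has a local maximum at `n` in the direction `y`
      set φ : ℝ → ℝ := fun ε => 2 * minkowskiDot y (T *ᵥ n) * ε
        + minkowskiDot y (T *ᵥ y) * (ε * ε) with hφ
      have hφeq : ∀ ε : ℝ, φ ε = minkowskiDot (n + ε • y) (T *ᵥ (n + ε • y)) := fun ε => by
        have h1 : minkowskiDot n (T *ᵥ y) = minkowskiDot y (T *ᵥ n) := by
          rw [minkowskiDot_mulVec_right, hTadj, minkowskiDot_comm]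
        have h2 : minkowskiDot n (T *ᵥ n) = 0 := by rw [hTf, hnn, sub_self]
        simp only [hφ, Matrix.mulVec_add, Matrix.mulVec_smul, minkowskiDot_add_left,
          minkowskiDot_add_right, minkowskiDot_smul_left, minkowskiDot_smul_right, h1, h2]
        ring
      have hloc : IsLocalMax φ 0 := by
        have hcont : Continuous fun ε : ℝ => n + ε • y := by fun_prop
        have hev : ∀ᶠ ε in nhds (0 : ℝ), n + ε • y ∈ futureCone d :=
          hcont.continuousAt.eventually (isOpen_futureCone.mem_nhds (by simpa using hnmem))
        filter_upwards [hev] with ε hε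
        rw [hφeq ε]
        simpa [hφ] using hle _ hε
      have hder : HasDerivAt φ (2 * minkowskiDot y (T *ᵥ n)) 0 := by
        have h1 := (hasDerivAt_id (0 : ℝ)).const_mul (2 * minkowskiDot y (T *ᵥ n))
        have h2 := (((hasDerivAt_id (0 : ℝ)).mul (hasDerivAt_id (0 : ℝ))).const_mul
          (minkowskiDot y (T *ᵥ y)))
        exact (h1.add h2).congr_deriv (by simp)
      have := hloc.hasDerivAt_eq_zero hder
      linarith
    exact hKne n hn (hker r hrpos.le n hTn)

/-- If all eigenvalues of `M̄⁻¹ M` are positive, `M = Λ U²` with `U` fixing a causal vector `n`. The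
imaginary parts of `z` and `U² z` then have the same product with `n`, so `Λ` cannot exchange the
future and the past if `z` and `M z` lie in the forward tube. -/
theorem hasPolarDecomposition_of_positiveEigenvalues (hM : minkowskiAdj M * M = 1)
    (hpos : PositiveEigenvalues (realityDefect M)) {z : Fin (d + 1) → ℂ} (hz : z ∈ forwardTube d)
    (hMz : M *ᵥ z ∈ forwardTube d) : HasPolarDecomposition M := by
  obtain ⟨U, hU, hUpos, hUU, -⟩ := exists_fourth_root hM hpos
  obtain ⟨A, hA, hAM⟩ := exists_real_factor hM hU hUU
  obtain ⟨C, S, hCS, hC, hS, hcomm, h1, hSU⟩ := hU.exists_cos_sin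
  have hdet : ∀ c : ℝ, 0 ≤ c → (1 - c • (S * S)).det ≠ 0 := fun c hc =>
    hU.det_one_sub_smul_ne_zero hUpos hSU hc
  refine ⟨A, C, S, ?_, hC, hS, hcomm, h1, fun c hc => hdet c hc.1, by rw [hCS, hAM]⟩
  obtain ⟨n, hn0, hnt, hnn, hSn⟩ := exists_causal_mulVec_eq_zero hS hdet
  have hUn : U *ᵥ ofRealVec n = ofRealVec (C *ᵥ n) := by
    rw [← hCS, Matrix.add_mulVec, Matrix.smul_mulVec, complexify_mulVec_ofRealVec,
      complexify_mulVec_ofRealVec, hSn]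
    funext i; simp [ofRealVec]
  have hSCn : S *ᵥ (C *ᵥ n) = 0 := by
    rw [Matrix.mulVec_mulVec, ← hcomm.eq, ← Matrix.mulVec_mulVec, hSn, Matrix.mulVec_zero]
  have hCCn : C *ᵥ (C *ᵥ n) = n := by
    have := congrArg (· *ᵥ n) h1
    simpa [Matrix.add_mulVec, ← Matrix.mulVec_mulVec, hSn] using this
  have hUUn : (U * U) *ᵥ ofRealVec n = ofRealVec n := by
    rw [← Matrix.mulVec_mulVec, hUn]
    conv_lhs => rw [← hCS]
    rw [Matrix.add_mulVec, Matrix.smul_mulVec, complexify_mulVec_ofRealVec,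
      complexify_mulVec_ofRealVec, hSCn, hCCn]
    funext i; simp [ofRealVec]
  have hULor : minkowskiAdj U * U = 1 := by rw [hU.2, hU.1]
  set q := imVec ((U * U) *ᵥ z) with hq
  have hnq : minkowskiDot n q = minkowskiDot n (imVec z) := by
    rw [← im_minkowskiDot_ofRealVec, ← im_minkowskiDot_ofRealVec, ← hUUn,
      minkowskiDot_mulVec_mulVec (minkowskiAdj_mul_self_mul hULor hULor), hUUn]
  have hAq : A *ᵥ q ∈ futureCone d := by
    rw [hq, ← imVec_complexify_mulVec, Matrix.mulVec_mulVec, hAM]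
    exact hMz
  have hqq : 0 < minkowskiDot q q := by
    rw [← minkowskiDot_mulVec_mulVec hA]; exact hAq.2
  have hnp : 0 < minkowskiDot n (imVec z) := by
    rw [minkowskiDot_comm]; exact minkowskiDot_pos hz hnt hnn hn0
  refine mem_orthochronousLorentz_of_mem hA ?_ hAq
  rcases mem_futureCone_or_neg_mem hqq with h | h
  · exact h
  · have := minkowskiDot_pos h hnt hnn hn0
    rw [minkowskiDot_neg_left, minkowskiDot_comm, hnq] at this
    linarith

end Positive

/-! ### Complex boosts in the plane of two null vectors -/

section NullBoost

variable {K : Type*} [Field K] {d : ℕ}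

/-- The complex boost that multiplies the null vector `n` by `γ` and the null vector `m` by `γ⁻¹`
and fixes the vectors orthogonal to both; it is meaningful when `n · m ≠ 0`. -/
def nullBoost (n m : Fin (d + 1) → K) (γ : K) : Matrix (Fin (d + 1)) (Fin (d + 1)) K :=
  1 + ((γ - 1) / minkowskiDot n m) • Matrix.vecMulVec n (minkowskiMetric K d *ᵥ m)
    + ((γ⁻¹ - 1) / minkowskiDot n m) • Matrix.vecMulVec m (minkowskiMetric K d *ᵥ n)

variable {n m : Fin (d + 1) → K}

theorem nullBoost_mulVec (n m : Fin (d + 1) → K) (γ : K) (v : Fin (d + 1) → K) :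
    nullBoost n m γ *ᵥ v = v + ((γ - 1) / minkowskiDot n m * minkowskiDot m v) • n
      + ((γ⁻¹ - 1) / minkowskiDot n m * minkowskiDot n v) • m := by
  rw [nullBoost, Matrix.add_mulVec, Matrix.add_mulVec, Matrix.one_mulVec, Matrix.smul_mulVec,
    Matrix.smul_mulVec, Matrix.vecMulVec_mulVec, Matrix.vecMulVec_mulVec, minkowskiDot_comm m v,
    minkowskiDot_comm n v, minkowskiDot_eq_dotProduct v, minkowskiDot_eq_dotProduct v,
    dotProduct_comm, dotProduct_comm (minkowskiMetric K d *ᵥ n), op_smul_eq_smul, op_smul_eq_smul,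
    smul_smul, smul_smul]

theorem nullBoost_one (n m : Fin (d + 1) → K) : nullBoost n m 1 = 1 := by
  simp [nullBoost]

theorem nullBoost_mulVec_of_orthogonal (γ : K) {v : Fin (d + 1) → K} (hn : minkowskiDot n v = 0)
    (hm : minkowskiDot m v = 0) : nullBoost n m γ *ᵥ v = v := by
  rw [nullBoost_mulVec, hn, hm]; simp

theorem nullBoost_mulVec_left (hn : minkowskiDot n n = 0) (hk : minkowskiDot n m ≠ 0) (γ : K) :
    nullBoost n m γ *ᵥ n = γ • n := by
  rw [nullBoost_mulVec, hn, minkowskiDot_comm m n, div_mul_cancel₀ _ hk]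
  module

theorem nullBoost_mulVec_right (hm : minkowskiDot m m = 0) (hk : minkowskiDot n m ≠ 0) (γ : K) :
    nullBoost n m γ *ᵥ m = γ⁻¹ • m := by
  rw [nullBoost_mulVec, hm, div_mul_cancel₀ _ hk]
  module

theorem nullBoost_mul (hn : minkowskiDot n n = 0) (hm : minkowskiDot m m = 0)
    (hk : minkowskiDot n m ≠ 0) (γ δ : K) :
    nullBoost n m γ * nullBoost n m δ = nullBoost n m (γ * δ) := by
  refine Matrix.ext_of_mulVec_single fun i => ?_
  rw [← Matrix.mulVec_mulVec, nullBoost_mulVec n m δ, Matrix.mulVec_add, Matrix.mulVec_add,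
    Matrix.mulVec_smul, Matrix.mulVec_smul, nullBoost_mulVec_left hn hk,
    nullBoost_mulVec_right hm hk, nullBoost_mulVec, nullBoost_mulVec, mul_inv]
  module

theorem minkowskiAdj_nullBoost (n m : Fin (d + 1) → K) (γ : K) :
    minkowskiAdj (nullBoost n m γ) = nullBoost n m γ⁻¹ := by
  refine minkowskiAdj_unique _ _ fun x y => ?_
  simp only [nullBoost_mulVec, minkowskiDot_add_left, minkowskiDot_smul_left, inv_inv,
    minkowskiDot_comm x]
  ring

theorem commute_nullBoost {U : Matrix (Fin (d + 1)) (Fin (d + 1)) K} (hn : U *ᵥ n = n)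
    (hm : U *ᵥ m = m) (hn' : minkowskiAdj U *ᵥ n = n) (hm' : minkowskiAdj U *ᵥ m = m) (γ : K) :
    Commute U (nullBoost n m γ) := by
  refine Matrix.ext_of_mulVec_single fun i => ?_
  rw [← Matrix.mulVec_mulVec, ← Matrix.mulVec_mulVec, nullBoost_mulVec, nullBoost_mulVec,
    Matrix.mulVec_add, Matrix.mulVec_add, Matrix.mulVec_smul, Matrix.mulVec_smul, hn, hm,
    minkowskiDot_mulVec_right U n, minkowskiDot_mulVec_right U m, hn', hm']

end NullBoost

theorem conjMatrix_nullBoost {d : ℕ} (n m : Fin (d + 1) → ℝ) (γ : ℂ) :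
    conjMatrix d (nullBoost (ofRealVec n) (ofRealVec m) γ)
      = nullBoost (ofRealVec n) (ofRealVec m) ((starRingEnd ℂ) γ) := by
  refine Matrix.ext_of_mulVec_single fun i => ?_
  have hreal : ∀ x v : Fin (d + 1) → ℂ, star x = x →
      (starRingEnd ℂ) (minkowskiDot x (star v)) = minkowskiDot x v := fun x v hx => by
    rw [← star_minkowskiDot, hx, star_star]
  have hk : (starRingEnd ℂ) (minkowskiDot (ofRealVec n) (ofRealVec m))
      = minkowskiDot (ofRealVec n) (ofRealVec m) := by
    rw [minkowskiDot_ofRealVec, Complex.conj_ofReal]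
  set v : Fin (d + 1) → ℂ := Pi.single i 1
  rw [← star_star v, conjMatrix_mulVec, nullBoost_mulVec, nullBoost_mulVec, star_add, star_add,
    star_smul, star_smul, star_ofRealVec, star_ofRealVec, star_star, ← hreal _ v (star_ofRealVec n),
    ← hreal _ v (star_ofRealVec m)]
  simp only [Complex.star_def, map_mul, map_div₀, map_sub, map_one, map_inv₀, hk]

/-! ### Polar decomposition in the presence of a complex boost -/

section Boost

variable {d : ℕ} {M : Matrix (Fin (d + 1)) (Fin (d + 1)) ℂ}

/-- The Hermitian square of a complex vector orthogonal to a real timelike vector is negative. -/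
theorem exists_minkowskiDot_star_eq_neg {e : Fin (d + 1) → ℝ} (he : 0 < minkowskiDot e e)
    {v : Fin (d + 1) → ℂ} (hv : v ≠ 0) (hev : minkowskiDot (ofRealVec e) v = 0) :
    ∃ s : ℝ, 0 < s ∧ minkowskiDot v (star v) = -s := by
  set x := reVec v
  set y := imVec v
  have hxy : ofRealVec x + Complex.I • ofRealVec y = v := ofRealVec_re_add_im v
  have hst : star v = ofRealVec x - Complex.I • ofRealVec y := by
    rw [← hxy, star_add, star_smul, star_ofRealVec, star_ofRealVec, Complex.star_def,
      Complex.conj_I, neg_smul, sub_eq_add_neg]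
  rw [← hxy, minkowskiDot_add_right, minkowskiDot_smul_right, minkowskiDot_ofRealVec,
    minkowskiDot_ofRealVec] at hev
  have hx : minkowskiDot e x = 0 := by simpa using congrArg Complex.re hev
  have hy : minkowskiDot e y = 0 := by simpa using congrArg Complex.im hev
  have hval : minkowskiDot v (star v) = ((minkowskiDot x x + minkowskiDot y y : ℝ) : ℂ) := by
    rw [hst]
    conv_lhs => rw [← hxy]
    simp only [minkowskiDot_add_left, minkowskiDot_sub_right, minkowskiDot_smul_left,
      minkowskiDot_smul_right, minkowskiDot_ofRealVec, minkowskiDot_comm y x]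
    push_cast
    linear_combination -(minkowskiDot y y : ℝ) * Complex.I_mul_I
  have he0 := ne_zero_of_minkowskiDot_self_ne_zero he.ne'
  have hx' := minkowskiDot_self_nonpos_of_orthogonal he0 he.le hx
  have hy' := minkowskiDot_self_nonpos_of_orthogonal he0 he.le hy
  refine ⟨-(minkowskiDot x x + minkowskiDot y y), ?_, by rw [hval]; push_cast; ring⟩
  by_contra! hle
  have h1 : x = 0 := by
    by_contra h; linarith [minkowskiDot_self_neg_of_orthogonal he hx h]
  have h2 : y = 0 := by
    by_contra h; linarith [minkowskiDot_self_neg_of_orthogonal he hy h]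
  refine hv ?_
  rw [← hxy, h1, h2]
  funext i; simp [ofRealVec]

/-- If `M̄⁻¹ M v = a v`, then `M v̄` is `ā⁻¹` times the conjugate of `M v`. -/
theorem mulVec_star_of_realityDefect (hM : minkowskiAdj M * M = 1) {v : Fin (d + 1) → ℂ} {a : ℂ}
    (ha0 : a ≠ 0) (ha : realityDefect M *ᵥ v = a • v) :
    M *ᵥ star v = ((starRingEnd ℂ) a)⁻¹ • star (M *ᵥ v) := by
  have h1 : M *ᵥ v = a • (conjMatrix d M *ᵥ v) := by
    conv_lhs => rw [← conjMatrix_mul_realityDefect hM]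
    rw [← Matrix.mulVec_mulVec, ha, Matrix.mulVec_smul]
  have h2 : M *ᵥ star v = star (conjMatrix d M *ᵥ v) := by
    rw [← conjMatrix_mulVec, conjMatrix_conjMatrix]
  have h3 : (starRingEnd ℂ) a ≠ 0 := by simpa using ha0
  rw [h1, star_smul, ← h2, smul_smul, Complex.star_def, inv_mul_cancel₀ h3, one_smul]

theorem mulVec_ne_zero_of_lorentz (hM : minkowskiAdj M * M = 1) {v : Fin (d + 1) → ℂ}
    (hv : v ≠ 0) : M *ᵥ v ≠ 0 := fun h => hv <| by
  rw [← Matrix.one_mulVec v, ← hM, ← Matrix.mulVec_mulVec, h, Matrix.mulVec_zero]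

/-- If `M` maps a real timelike vector to a real vector, the eigenvalues of `M̄⁻¹ M` are positive:
for an eigenvalue `a ≠ 1` the eigenvector `v` and its image `w = M v` are orthogonal to real
timelike vectors, and `v · v̄ = ā⁻¹ w · w̄`. -/
theorem positiveEigenvalues_of_timelike (hM : minkowskiAdj M * M = 1) {e e' : Fin (d + 1) → ℝ}
    (he : 0 < minkowskiDot e e) (hMe : M *ᵥ ofRealVec e = ofRealVec e') :
    PositiveEigenvalues (realityDefect M) := by
  have hN := isImaginaryLorentz_realityDefect hM
  have hNL : minkowskiAdj (realityDefect M) * realityDefect M = 1 := by rw [hN.2, hN.1]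
  intro v a hv ha
  by_cases ha1 : a = 1
  · exact ⟨1, one_pos, by simpa using ha1⟩
  obtain ⟨ha0, -⟩ := mulVec_conjMatrix_of_eigenvector hN.1 hv ha
  have hev : minkowskiDot (ofRealVec e) v = 0 := by
    have h1 := minkowskiDot_mulVec_mulVec hNL (ofRealVec e) v
    rw [realityDefect_mulVec_ofRealVec hM hMe, ha, minkowskiDot_smul_right] at h1
    have h2 : (a - 1) * minkowskiDot (ofRealVec e) v = 0 := by linear_combination h1
    exact (mul_eq_zero.mp h2).resolve_left (sub_ne_zero.mpr ha1)
  have hee : minkowskiDot e' e' = minkowskiDot e e := by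
    have h1 := minkowskiDot_mulVec_mulVec hM (ofRealVec e) (ofRealVec e)
    rw [hMe, minkowskiDot_ofRealVec, minkowskiDot_ofRealVec] at h1
    exact_mod_cast h1
  have hew : minkowskiDot (ofRealVec e') (M *ᵥ v) = 0 := by
    rw [← hMe, minkowskiDot_mulVec_mulVec hM, hev]
  obtain ⟨s, hs, hsv⟩ := exists_minkowskiDot_star_eq_neg he hv hev
  obtain ⟨t, ht, htw⟩ := exists_minkowskiDot_star_eq_neg (hee ▸ he)
    (mulVec_ne_zero_of_lorentz hM hv) hew
  have h1 := minkowskiDot_mulVec_mulVec hM v (star v)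
  rw [mulVec_star_of_realityDefect hM ha0 ha, minkowskiDot_smul_right, htw, hsv] at h1
  have h3 : (starRingEnd ℂ) a ≠ 0 := by simpa using ha0
  have hs0 : (s : ℂ) ≠ 0 := by exact_mod_cast hs.ne'
  have h2 : (starRingEnd ℂ) a = ((t / s : ℝ) : ℂ) := by
    push_cast
    field_simp at h1 ⊢
    linear_combination h1
  refine ⟨t / s, div_pos ht hs, ?_⟩
  rw [← Complex.conj_conj a, h2, Complex.conj_ofReal]

theorem exists_unit_sqrt {μ : ℂ} (hμ : (starRingEnd ℂ) μ * μ = 1) :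
    ∃ β : ℂ, β * β = μ ∧ (starRingEnd ℂ) β * β = 1 := by
  obtain ⟨β, hβ⟩ := IsAlgClosed.exists_pow_nat_eq μ (n := 2) two_pos
  refine ⟨β, by rw [← sq, hβ], ?_⟩
  rw [← hβ, map_pow, ← mul_pow, ← Complex.normSq_eq_conj_mul_self] at hμ
  have h1 : Complex.normSq β ^ 2 = 1 := by exact_mod_cast hμ
  have h2 : Complex.normSq β = 1 := by nlinarith [Complex.normSq_nonneg β]
  rw [← Complex.normSq_eq_conj_mul_self, h2, Complex.ofReal_one]

/-- Suppose that `M` maps two real null vectors `n`, `m` to `β n'`, `β⁻¹ m'` with `n'`, `m'` real,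
`|β| = 1`, `β ≠ -1`, and that the time orientations agree. Up to the boost with parameter `β` in the
plane of `n` and `m`, the matrix `M` maps the real timelike vector `n + m` to a real vector. As
`β ≠ -1`, the boost is the square of one with parameter `γ ≠ ±i`, whose sine has the eigenvalues
`± Im γ` of modulus less than `1` on the plane. -/
theorem hasPolarDecomposition_of_nullPair (hM : minkowskiAdj M * M = 1)
    {n m n' m' : Fin (d + 1) → ℝ} (hn : minkowskiDot n n = 0) (hm : minkowskiDot m m = 0)
    (hk : minkowskiDot n m ≠ 0) (hfut : n + m ∈ futureCone d) (hfut' : n' + m' ∈ futureCone d)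
    {β : ℂ} (hβ : (starRingEnd ℂ) β * β = 1) (hβ1 : β ≠ -1)
    (hMn : M *ᵥ ofRealVec n = β • ofRealVec n') (hMm : M *ᵥ ofRealVec m = β⁻¹ • ofRealVec m') :
    HasPolarDecomposition M := by
  set a := ofRealVec n with ha
  set b := ofRealVec m with hb
  have hn' : minkowskiDot a a = 0 := by rw [ha, minkowskiDot_ofRealVec, hn]; rfl
  have hm' : minkowskiDot b b = 0 := by rw [hb, minkowskiDot_ofRealVec, hm]; rfl
  have hk' : minkowskiDot a b ≠ 0 := by
    rw [ha, hb, minkowskiDot_ofRealVec]; exact_mod_cast hk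
  have hβ0 : β ≠ 0 := right_ne_zero_of_mul_eq_one hβ
  -- a square root `γ` of `β`; it is not `±i`
  obtain ⟨γ, hγβ, hγ, hγre⟩ : ∃ γ : ℂ, γ * γ = β ∧ (starRingEnd ℂ) γ * γ = 1 ∧ γ.re ≠ 0 := by
    obtain ⟨γ, h1, h2⟩ := exists_unit_sqrt hβ
    refine ⟨γ, h1, h2, fun hre => hβ1 ?_⟩
    have h3 : (starRingEnd ℂ) γ = -γ := by
      apply Complex.ext <;> simp [hre]
    rw [h3] at h2
    rw [← h1]
    linear_combination -h2
  have hγ0 : γ ≠ 0 := right_ne_zero_of_mul_eq_one hγ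
  have hγinv : γ⁻¹ = (starRingEnd ℂ) γ := (eq_inv_of_mul_eq_one_left hγ).symm
  set R := nullBoost a b with hR
  have hRR : ∀ x y, R x * R y = R (x * y) := nullBoost_mul hn' hm' hk'
  have hRadj : ∀ x, minkowskiAdj (R x) = R x⁻¹ := minkowskiAdj_nullBoost a b
  have hRcj : ∀ x, conjMatrix d (R x) = R ((starRingEnd ℂ) x) := conjMatrix_nullBoost n m
  have hRa : ∀ x, R x *ᵥ a = x • a := nullBoost_mulVec_left hn' hk'
  have hRb : ∀ x, R x *ᵥ b = x⁻¹ • b := nullBoost_mulVec_right hm' hk'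
  have hR1 : R 1 = 1 := nullBoost_one a b
  -- `M₀ = M R(β)⁻¹` is real on `n` and `m`
  set M₀ := M * R β⁻¹ with hM₀
  have hM₀L : minkowskiAdj M₀ * M₀ = 1 := by
    refine minkowskiAdj_mul_self_mul hM ?_
    rw [hRadj, hRR, inv_inv, mul_inv_cancel₀ hβ0, hR1]
  have hM₀a : M₀ *ᵥ a = ofRealVec n' := by
    rw [hM₀, ← Matrix.mulVec_mulVec, hRa, Matrix.mulVec_smul, hMn, smul_smul,
      inv_mul_cancel₀ hβ0, one_smul]
  have hM₀b : M₀ *ᵥ b = ofRealVec m' := by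
    rw [hM₀, ← Matrix.mulVec_mulVec, hRb, inv_inv, Matrix.mulVec_smul, hMm, smul_smul,
      mul_inv_cancel₀ hβ0, one_smul]
  have hadd : ∀ x y : Fin (d + 1) → ℝ, ofRealVec (x + y) = ofRealVec x + ofRealVec y := by
    intro x y; funext i; simp [ofRealVec]
  have hM₀e : M₀ *ᵥ ofRealVec (n + m) = ofRealVec (n' + m') := by
    rw [hadd, hadd, Matrix.mulVec_add, ← ha, ← hb, hM₀a, hM₀b]
  have hpos := positiveEigenvalues_of_timelike hM₀L hfut.2 hM₀e
  obtain ⟨U₀, hU₀, hU₀pos, hU₀4, hU₀fix⟩ := exists_fourth_root hM₀L hpos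
  obtain ⟨A, hA, hAM⟩ := exists_real_factor hM₀L hU₀ hU₀4
  have hU₀a : U₀ *ᵥ a = a := hU₀fix _ (realityDefect_mulVec_ofRealVec hM₀L hM₀a)
  have hU₀b : U₀ *ᵥ b = b := hU₀fix _ (realityDefect_mulVec_ofRealVec hM₀L hM₀b)
  have hV₀a : conjMatrix d U₀ *ᵥ a = a := by
    rw [ha, ← star_ofRealVec n, conjMatrix_mulVec, ← ha, hU₀a]
  have hV₀b : conjMatrix d U₀ *ᵥ b = b := by
    rw [hb, ← star_ofRealVec m, conjMatrix_mulVec, ← hb, hU₀b]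
  have hAmem : A ∈ orthochronousLorentz d := by
    refine mem_orthochronousLorentz_of_mem hA hfut ?_
    have h1 : complexify d A *ᵥ ofRealVec (n + m) = ofRealVec (n' + m') := by
      rw [← hM₀e, ← hAM, ← Matrix.mulVec_mulVec, ← Matrix.mulVec_mulVec, hadd,
        Matrix.mulVec_add U₀, ← ha, ← hb, hU₀a, hU₀b, Matrix.mulVec_add U₀, hU₀a, hU₀b]
    rw [complexify_mulVec_ofRealVec] at h1
    rw [ofRealVec_injective h1]
    exact hfut'
  have hcomm : ∀ x, Commute U₀ (R x) := fun x => by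
    refine commute_nullBoost hU₀a hU₀b ?_ ?_ x
    · rw [hU₀.2, hV₀a]
    · rw [hU₀.2, hV₀b]
  set U := U₀ * R γ with hU
  have hUcj : conjMatrix d U = conjMatrix d U₀ * R γ⁻¹ := by rw [hU, map_mul, hRcj, hγinv]
  have hcomm' : Commute (conjMatrix d U₀) (R γ⁻¹) := by
    have := (hcomm γ).map (conjMatrix d)
    rwa [hRcj, ← hγinv] at this
  have hUim : IsImaginaryLorentz U := by
    refine ⟨?_, ?_⟩
    · rw [hUcj, hU, hcomm'.eq, mul_assoc, ← mul_assoc _ U₀, hU₀.1, one_mul, hRR,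
        inv_mul_cancel₀ hγ0, hR1]
    · rw [hUcj, hU, minkowskiAdj_mul, hU₀.2, hRadj, hcomm'.eq]
  have hUM : complexify d A * (U * U) = M := by
    have h1 : U * U = (U₀ * U₀) * R β := by
      rw [hU, (hcomm γ).symm.mul_mul_mul_comm, hRR, hγβ]
    rw [h1, ← mul_assoc, hAM, hM₀, mul_assoc, hRR, inv_mul_cancel₀ hβ0, hR1, mul_one]
  obtain ⟨C, S, hCS, hC, hS, hCScomm, h1, hSU⟩ := hUim.exists_cos_sin
  obtain ⟨-, S₀, -, -, hS₀, -, -, hSU₀⟩ := hU₀.exists_cos_sin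
  refine ⟨A, C, S, hAmem, hC, hS, hCScomm, h1, fun c hc hdet => ?_, by rw [hCS, hUM]⟩
  obtain ⟨v, hv, hv0⟩ := Matrix.exists_mulVec_eq_zero_iff.mpr hdet
  have hvc : v = c • (S *ᵥ (S *ᵥ v)) := by
    rw [Matrix.sub_mulVec, Matrix.one_mulVec, Matrix.smul_mulVec, sub_eq_zero] at hv0
    rwa [Matrix.mulVec_mulVec]
  have hUV : ∀ x : Fin (d + 1) → ℝ, ofRealVec (S *ᵥ x)
      = (2 * Complex.I)⁻¹ • (U *ᵥ ofRealVec x - conjMatrix d U *ᵥ ofRealVec x) := fun x => by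
    rw [← complexify_mulVec_ofRealVec, hSU, Matrix.smul_mulVec, Matrix.sub_mulVec]
  have hUV₀ : ∀ x : Fin (d + 1) → ℝ, ofRealVec (S₀ *ᵥ x)
      = (2 * Complex.I)⁻¹ • (U₀ *ᵥ ofRealVec x - conjMatrix d U₀ *ᵥ ofRealVec x) := fun x => by
    rw [← complexify_mulVec_ofRealVec, hSU₀, Matrix.smul_mulVec, Matrix.sub_mulVec]
  have hsub : (2 * Complex.I)⁻¹ * (γ - γ⁻¹) = ((γ.im : ℝ) : ℂ) := by
    rw [hγinv, Complex.sub_conj]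
    push_cast
    field_simp
  have hsmul : ∀ (r : ℝ) (x : Fin (d + 1) → ℝ), ofRealVec (r • x) = (r : ℂ) • ofRealVec x := by
    intro r x; funext i; simp [ofRealVec]
  have hSn : S *ᵥ n = γ.im • n := by
    apply ofRealVec_injective
    rw [hUV, hUcj, hU, ← ha, ← Matrix.mulVec_mulVec, ← Matrix.mulVec_mulVec, hRa, hRa,
      Matrix.mulVec_smul, Matrix.mulVec_smul, hU₀a, hV₀a, ← sub_smul, smul_smul, hsub, hsmul]
  have hSm : S *ᵥ m = (-γ.im) • m := by
    apply ofRealVec_injective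
    rw [hUV, hUcj, hU, ← hb, ← Matrix.mulVec_mulVec, ← Matrix.mulVec_mulVec, hRb, hRb, inv_inv,
      Matrix.mulVec_smul, Matrix.mulVec_smul, hU₀b, hV₀b, ← sub_smul, smul_smul, hsmul]
    congr 1
    push_cast
    linear_combination -hsub
  have hS₀n : S₀ *ᵥ n = 0 := by
    apply ofRealVec_injective
    rw [hUV₀, ← ha, hU₀a, hV₀a, sub_self, smul_zero]
    funext i; simp [ofRealVec]
  have hS₀m : S₀ *ᵥ m = 0 := by
    apply ofRealVec_injective
    rw [hUV₀, ← hb, hU₀b, hV₀b, sub_self, smul_zero]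
    funext i; simp [ofRealVec]
  have hs : c * (γ.im * γ.im) < 1 := by
    have h2 : γ.re * γ.re + γ.im * γ.im = 1 := by
      rw [← Complex.normSq_eq_conj_mul_self] at hγ
      rw [← Complex.normSq_apply]
      exact_mod_cast hγ
    have h3 : 0 < γ.re * γ.re := mul_self_pos.mpr hγre
    nlinarith [hc.1, hc.2, mul_self_nonneg γ.im]
  -- `v` is orthogonal to `n` and `m`, and there `S` agrees with `S₀`
  have horth : ∀ x : Fin (d + 1) → ℝ, S *ᵥ (S *ᵥ x) = (γ.im * γ.im) • x →
      minkowskiDot x v = 0 := fun x hx => by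
    have h2 : minkowskiDot x v = c * (γ.im * γ.im) * minkowskiDot x v := by
      conv_lhs => rw [hvc, minkowskiDot_smul_right, minkowskiDot_mulVec_skew hS, minkowskiDot_comm,
        ← minkowskiDot_mulVec_skew hS, hx, minkowskiDot_smul_right, minkowskiDot_comm]
      ring
    have h3 : (1 - c * (γ.im * γ.im)) * minkowskiDot x v = 0 := by linarith
    exact (mul_eq_zero.mp h3).resolve_left (by linarith)
  have hnv : minkowskiDot n v = 0 := horth n (by
    rw [hSn, Matrix.mulVec_smul, hSn, smul_smul])
  have hmv : minkowskiDot m v = 0 := horth m (by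
    rw [hSm, Matrix.mulVec_smul, hSm, smul_smul]; congr 1; ring)
  have hagree : ∀ x, minkowskiDot n x = 0 → minkowskiDot m x = 0 → S *ᵥ x = S₀ *ᵥ x := by
    intro x hnx hmx
    apply ofRealVec_injective
    have hax : minkowskiDot a (ofRealVec x) = 0 := by
      rw [ha, minkowskiDot_ofRealVec, hnx, Complex.ofReal_zero]
    have hbx : minkowskiDot b (ofRealVec x) = 0 := by
      rw [hb, minkowskiDot_ofRealVec, hmx, Complex.ofReal_zero]
    have hRx : ∀ y, R y *ᵥ ofRealVec x = ofRealVec x := fun y =>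
      nullBoost_mulVec_of_orthogonal y hax hbx
    rw [hUV, hUV₀, hUcj, hU, ← Matrix.mulVec_mulVec, ← Matrix.mulVec_mulVec, hRx, hRx]
  have hSv : S *ᵥ v = S₀ *ᵥ v := hagree v hnv hmv
  have hSSv : S *ᵥ (S *ᵥ v) = S₀ *ᵥ (S₀ *ᵥ v) := by
    rw [hSv]
    refine hagree _ ?_ ?_
    · rw [minkowskiDot_mulVec_right, hS₀, Matrix.neg_mulVec, hS₀n, neg_zero, minkowskiDot_zero_left]
    · rw [minkowskiDot_mulVec_right, hS₀, Matrix.neg_mulVec, hS₀m, neg_zero, minkowskiDot_zero_left]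
  refine hU₀.det_one_sub_smul_ne_zero hU₀pos hSU₀ hc.1
    (Matrix.exists_mulVec_eq_zero_iff.mp ⟨v, hv, ?_⟩)
  rw [Matrix.sub_mulVec, Matrix.one_mulVec, Matrix.smul_mulVec, ← Matrix.mulVec_mulVec, ← hSSv,
    ← hvc, sub_self]

end Boost

/-! ### The eigenvalues of `M̄⁻¹ M` that are not positive -/

section Eigenvalues

variable {d : ℕ} {M : Matrix (Fin (d + 1)) (Fin (d + 1)) ℂ}

/-- A pair of real null vectors, not orthogonal to each other, that are eigenvectors of `N` with
eigenvalues `μ` and `μ⁻¹`, where `|μ| = 1` and `μ ≠ 1`. -/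
def HasNullEigenpair (N : Matrix (Fin (d + 1)) (Fin (d + 1)) ℂ) : Prop :=
  ∃ (n m : Fin (d + 1) → ℝ) (μ : ℂ), minkowskiDot n n = 0 ∧ minkowskiDot m m = 0 ∧
    minkowskiDot n m ≠ 0 ∧ (starRingEnd ℂ) μ * μ = 1 ∧ μ ≠ 1 ∧
    N *ᵥ ofRealVec n = μ • ofRealVec n ∧ N *ᵥ ofRealVec m = μ⁻¹ • ofRealVec m

/-- For a complex null vector `v = x + iy` one has `x² = y²` and `x · y = 0`; so either `x` and `y`
are both spacelike, or they are null and proportional. -/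
theorem complex_null_dichotomy {v : Fin (d + 1) → ℂ} (hv : v ≠ 0) (hvv : minkowskiDot v v = 0) :
    (∃ s : ℝ, 0 < s ∧ minkowskiDot v (star v) = -s) ∨
      ∃ (n : Fin (d + 1) → ℝ) (ζ : ℂ), n ≠ 0 ∧ ζ ≠ 0 ∧ minkowskiDot n n = 0 ∧
        v = ζ • ofRealVec n := by
  set x := reVec v with hx
  set y := imVec v with hy
  have hxy : ofRealVec x + Complex.I • ofRealVec y = v := ofRealVec_re_add_im v
  have hst : star v = ofRealVec x - Complex.I • ofRealVec y := by
    rw [← hxy, star_add, star_smul, star_ofRealVec, star_ofRealVec, Complex.star_def,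
      Complex.conj_I, neg_smul, sub_eq_add_neg]
  have hval : minkowskiDot v (star v) = ((minkowskiDot x x + minkowskiDot y y : ℝ) : ℂ) := by
    rw [hst]
    conv_lhs => rw [← hxy]
    simp only [minkowskiDot_add_left, minkowskiDot_sub_right, minkowskiDot_smul_left,
      minkowskiDot_smul_right, minkowskiDot_ofRealVec, minkowskiDot_comm y x]
    push_cast
    linear_combination -(minkowskiDot y y : ℝ) * Complex.I_mul_I
  have h0 : ((minkowskiDot x x - minkowskiDot y y : ℝ) : ℂ)
      + (2 * minkowskiDot x y : ℝ) * Complex.I = 0 := by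
    rw [← hvv]
    conv_rhs => rw [← hxy]
    simp only [minkowskiDot_add_left, minkowskiDot_add_right, minkowskiDot_smul_left,
      minkowskiDot_smul_right, minkowskiDot_ofRealVec, minkowskiDot_comm y x]
    push_cast
    linear_combination -(minkowskiDot y y : ℝ) * Complex.I_mul_I
  have h1 : minkowskiDot x x = minkowskiDot y y := by
    have := congrArg Complex.re h0
    simp at this
    linarith
  have h2 : minkowskiDot x y = 0 := by
    have := congrArg Complex.im h0
    simpa using this
  have hzero : ofRealVec (0 : Fin (d + 1) → ℝ) = 0 := by funext i; simp [ofRealVec]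
  rcases lt_trichotomy (minkowskiDot x x) 0 with h | h | h
  · left
    exact ⟨-(minkowskiDot x x + minkowskiDot y y), by linarith, by rw [hval]; push_cast; ring⟩
  · right
    by_cases hx0 : x = 0
    · have hy0 : y ≠ 0 := by
        intro hy0
        rw [← hxy, hx0, hy0, hzero] at hv
        simp at hv
      refine ⟨y, Complex.I, hy0, Complex.I_ne_zero, by rw [← h1, h], ?_⟩
      rw [← hxy, hx0, hzero, zero_add]
    · obtain ⟨c, hc⟩ := exists_smul_of_minkowskiDot_eq_zero hx0 h.ge h2 (by rw [← h1, h])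
      refine ⟨x, 1 + Complex.I * c, hx0, ?_, h, ?_⟩
      · intro h
        have := congrArg Complex.re h
        simp at this
      · conv_lhs => rw [← hxy, hc]
        funext i
        simp [ofRealVec]
        ring
  · have := minkowskiDot_self_neg_of_orthogonal h h2
      (ne_zero_of_minkowskiDot_self_ne_zero (by rw [← h1]; exact h.ne'))
    linarith

/-- An eigenvector of `M̄⁻¹ M` whose eigenvalue is neither `±1` nor positive is null; if it were not
proportional to a real vector, its Hermitian square and that of its image under `M` would both be
negative, while their ratio is the conjugate of the eigenvalue. -/
theorem exists_real_null_eigenvector (hM : minkowskiAdj M * M = 1) {v : Fin (d + 1) → ℂ} {a : ℂ}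
    (hv : v ≠ 0) (ha : realityDefect M *ᵥ v = a • v) (ha2 : a * a ≠ 1)
    (hpos : ¬ ∃ r : ℝ, 0 < r ∧ a = r) :
    ∃ n : Fin (d + 1) → ℝ, n ≠ 0 ∧ minkowskiDot n n = 0 ∧
      realityDefect M *ᵥ ofRealVec n = a • ofRealVec n := by
  have hN := isImaginaryLorentz_realityDefect hM
  have hNL : minkowskiAdj (realityDefect M) * realityDefect M = 1 := by rw [hN.2, hN.1]
  obtain ⟨ha0, -⟩ := mulVec_conjMatrix_of_eigenvector hN.1 hv ha
  have hvv : minkowskiDot v v = 0 := by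
    have h1 := minkowskiDot_mulVec_mulVec hNL v v
    rw [ha, minkowskiDot_smul_right, minkowskiDot_smul_left] at h1
    have h2 : (a * a - 1) * minkowskiDot v v = 0 := by linear_combination h1
    exact (mul_eq_zero.mp h2).resolve_left (sub_ne_zero.mpr ha2)
  have hww : minkowskiDot (M *ᵥ v) (M *ᵥ v) = 0 := by rw [minkowskiDot_mulVec_mulVec hM, hvv]
  have h1 := minkowskiDot_mulVec_mulVec hM v (star v)
  rw [mulVec_star_of_realityDefect hM ha0 ha, minkowskiDot_smul_right] at h1
  have h3 : (starRingEnd ℂ) a ≠ 0 := by simpa using ha0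
  rcases complex_null_dichotomy hv hvv with ⟨s, hs, hsv⟩ | ⟨n, ζ, hn, hζ, hnn, rfl⟩
  · exfalso
    rw [hsv] at h1
    have hs0 : (s : ℂ) ≠ 0 := by exact_mod_cast hs.ne'
    rcases complex_null_dichotomy (mulVec_ne_zero_of_lorentz hM hv) hww with
      ⟨t, ht, htw⟩ | ⟨n, ζ, -, -, hnn, hnw⟩
    · rw [htw] at h1
      have h2 : (starRingEnd ℂ) a = ((t / s : ℝ) : ℂ) := by
        push_cast
        field_simp at h1 ⊢
        linear_combination h1
      exact hpos ⟨t / s, div_pos ht hs, by rw [← Complex.conj_conj a, h2, Complex.conj_ofReal]⟩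
    · rw [hnw, star_smul, star_ofRealVec, minkowskiDot_smul_right, minkowskiDot_smul_left,
        minkowskiDot_ofRealVec, hnn] at h1
      simp at h1
      exact hs.ne' h1
  · refine ⟨n, hn, hnn, ?_⟩
    rw [Matrix.mulVec_smul, smul_comm] at ha
    exact smul_right_injective _ hζ ha

/-- A non-positive eigenvalue `a` with `a² ≠ 1`: the inverse `a⁻¹` is an eigenvalue as well, and the
real null eigenvectors of the two are not orthogonal, as they are not proportional. -/
theorem hasNullEigenpair_of_sq_ne_one (hM : minkowskiAdj M * M = 1) {v : Fin (d + 1) → ℂ} {a : ℂ}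
    (hv : v ≠ 0) (ha : realityDefect M *ᵥ v = a • v) (ha2 : a * a ≠ 1)
    (hpos : ¬ ∃ r : ℝ, 0 < r ∧ a = r) : HasNullEigenpair (realityDefect M) := by
  have hN := isImaginaryLorentz_realityDefect hM
  obtain ⟨ha0, -⟩ := mulVec_conjMatrix_of_eigenvector hN.1 hv ha
  obtain ⟨n, hn, hnn, hNn⟩ := exists_real_null_eigenvector hM hv ha ha2 hpos
  set N := realityDefect M with hNdef
  have hNcj : N * conjMatrix d N = 1 := mul_eq_one_comm.mp hN.1
  obtain ⟨u, hu, hau⟩ : ∃ u, u ≠ 0 ∧ N *ᵥ u = a⁻¹ • u := by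
    have h1 : (N - a • 1).det = 0 := Matrix.exists_mulVec_eq_zero_iff.mp
      ⟨v, hv, by rw [Matrix.sub_mulVec, Matrix.smul_mulVec, Matrix.one_mulVec, ha, sub_self]⟩
    rw [← det_minkowskiAdj, minkowskiAdj_sub, minkowskiAdj_smul, minkowskiAdj_one, hN.2] at h1
    obtain ⟨u, hu, hu0⟩ := Matrix.exists_mulVec_eq_zero_iff.mpr h1
    refine ⟨u, hu, ?_⟩
    rw [Matrix.sub_mulVec, Matrix.smul_mulVec, Matrix.one_mulVec, sub_eq_zero] at hu0
    have h2 := congrArg (N *ᵥ ·) hu0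
    simp only [Matrix.mulVec_mulVec, hNcj, Matrix.one_mulVec, Matrix.mulVec_smul] at h2
    conv_rhs => rw [h2, smul_smul, inv_mul_cancel₀ ha0, one_smul]
  obtain ⟨m, hm, hmm, hNm⟩ := exists_real_null_eigenvector hM hu hau
    (fun h => ha2 (by rw [← mul_inv, inv_eq_one] at h; exact h))
    (fun ⟨r, hr, h⟩ => hpos ⟨r⁻¹, inv_pos.mpr hr, by rw [Complex.ofReal_inv, ← h, inv_inv]⟩)
  have hunit : (starRingEnd ℂ) a = a⁻¹ := by
    have h1 := (mulVec_conjMatrix_of_eigenvector hN.1 (ofRealVec_ne_zero hn) hNn).2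
    have h2 : conjMatrix d N *ᵥ ofRealVec n = (starRingEnd ℂ) a • ofRealVec n := by
      rw [← star_ofRealVec, conjMatrix_mulVec, hNn, star_smul, star_ofRealVec, Complex.star_def]
    exact smul_left_injective ℂ (ofRealVec_ne_zero hn) (h2.symm.trans h1)
  refine ⟨n, m, a, hnn, hmm, fun h => ha2 ?_, by rw [hunit, inv_mul_cancel₀ ha0],
    fun h => ha2 (by rw [h, one_mul]), hNn, hNm⟩
  obtain ⟨c, rfl⟩ := exists_smul_of_minkowskiDot_eq_zero hn hnn.ge h hmm.ge
  have hc : (c : ℂ) ≠ 0 := by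
    rintro h
    have : c = 0 := by exact_mod_cast h
    rw [this, zero_smul] at hm
    exact hm rfl
  have h1 : ofRealVec (c • n) = (c : ℂ) • ofRealVec n := by funext i; simp [ofRealVec]
  have h2 := hNm
  rw [h1, Matrix.mulVec_smul, hNn, smul_comm] at h2
  have h3 : a = a⁻¹ := smul_left_injective ℂ (smul_ne_zero hc (ofRealVec_ne_zero hn)) h2
  calc a * a = a * a⁻¹ := by rw [← h3]
    _ = 1 := mul_inv_cancel₀ ha0

/-- The real eigenvectors of `M̄⁻¹ M` with eigenvalue `-1` are mapped by `M` to purely imaginary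
vectors. -/
theorem exists_mulVec_eq_I_smul (hM : minkowskiAdj M * M = 1) {x : Fin (d + 1) → ℝ}
    (hx : realityDefect M *ᵥ ofRealVec x = (-1 : ℂ) • ofRealVec x) :
    ∃ y, M *ᵥ ofRealVec x = Complex.I • ofRealVec y := by
  have h1 := mulVec_star_of_realityDefect hM (by simp) hx
  rw [star_ofRealVec, map_neg, map_one, inv_neg, inv_one, neg_one_smul] at h1
  have h2 : star (-(Complex.I • (M *ᵥ ofRealVec x))) = -(Complex.I • (M *ᵥ ofRealVec x)) := by
    conv_rhs => rw [h1]
    rw [star_neg, star_smul, Complex.star_def, Complex.conj_I, neg_smul, smul_neg]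
  obtain ⟨y, hy⟩ := exists_ofRealVec_eq h2
  refine ⟨y, ?_⟩
  rw [hy, smul_neg, smul_smul, Complex.I_mul_I, neg_one_smul, neg_neg]

theorem minkowskiDot_of_mulVec_eq_I_smul (hM : minkowskiAdj M * M = 1) {x y x' y' : Fin (d + 1) → ℝ}
    (hx : M *ᵥ ofRealVec x = Complex.I • ofRealVec x')
    (hy : M *ᵥ ofRealVec y = Complex.I • ofRealVec y') :
    minkowskiDot x' y' = -minkowskiDot x y := by
  have h1 := minkowskiDot_mulVec_mulVec hM (ofRealVec x) (ofRealVec y)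
  rw [hx, hy, minkowskiDot_smul_left, minkowskiDot_smul_right, minkowskiDot_ofRealVec,
    minkowskiDot_ofRealVec, ← mul_assoc, Complex.I_mul_I, neg_one_mul] at h1
  have h2 : -minkowskiDot x' y' = minkowskiDot x y := by exact_mod_cast h1
  linarith

/-- The eigenspace of `-1` is closed under conjugation. -/
theorem reVec_imVec_eigenvector_neg_one {N : Matrix (Fin (d + 1)) (Fin (d + 1)) ℂ}
    (hN : conjMatrix d N * N = 1) {v : Fin (d + 1) → ℂ} (hv : N *ᵥ v = (-1 : ℂ) • v) :
    N *ᵥ ofRealVec (reVec v) = (-1 : ℂ) • ofRealVec (reVec v) ∧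
      N *ᵥ ofRealVec (imVec v) = (-1 : ℂ) • ofRealVec (imVec v) := by
  have h1 : conjMatrix d N *ᵥ v = (-1 : ℂ) • v := by
    rcases eq_or_ne v 0 with rfl | hv0
    · simp
    · simpa using (mulVec_conjMatrix_of_eigenvector hN hv0 hv).2
  have h2 : N *ᵥ star v = (-1 : ℂ) • star v := by
    rw [← conjMatrix_conjMatrix N, conjMatrix_mulVec, h1, star_smul]; simp
  have h3 : ofRealVec (reVec v) = (2 : ℂ)⁻¹ • (v + star v) := by
    funext i
    simp [ofRealVec, reVec, Complex.re_eq_add_conj, div_eq_inv_mul]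
  have h4 : ofRealVec (imVec v) = (2 * Complex.I)⁻¹ • (v - star v) := by
    funext i
    simp only [ofRealVec, imVec, Complex.im_eq_sub_conj, div_eq_inv_mul, Pi.smul_apply,
      Pi.sub_apply, Pi.star_apply, Complex.star_def, smul_eq_mul]
  rw [h3, h4, Matrix.mulVec_smul, Matrix.mulVec_smul, Matrix.mulVec_add, Matrix.mulVec_sub, hv, h2]
  constructor <;> module

/-- A real null eigenvector `x` of `N = M̄⁻¹ M` for the eigenvalue `-1` is not in the range of
`N + 1`. Otherwise there is a real `y ⟂ x` with `N y = -y - i x`; it is spacelike, so that the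
imaginary part of `M y` is timelike, but this is orthogonal to the null vector `-i M x`. -/
theorem add_one_mulVec_ne (hM : minkowskiAdj M * M = 1) {x : Fin (d + 1) → ℝ} (hx0 : x ≠ 0)
    (hxx : minkowskiDot x x = 0)
    (hx : realityDefect M *ᵥ ofRealVec x = (-1 : ℂ) • ofRealVec x) (u : Fin (d + 1) → ℂ) :
    (realityDefect M + 1) *ᵥ u ≠ ofRealVec x := by
  intro hu
  have hN := isImaginaryLorentz_realityDefect hM
  have hNL : minkowskiAdj (realityDefect M) * realityDefect M = 1 := by rw [hN.2, hN.1]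
  have hMcj := conjMatrix_mul_realityDefect hM
  set N := realityDefect M with hNdef
  have hNu : N *ᵥ u = ofRealVec x - u := by
    rw [← hu, Matrix.add_mulVec, Matrix.one_mulVec]; abel
  have hNsu : N *ᵥ star u = -star u - ofRealVec x := by
    have h1 : conjMatrix d N *ᵥ star u = ofRealVec x - star u := by
      rw [conjMatrix_mulVec, hNu, star_sub, star_ofRealVec]
    have h2 := congrArg (N *ᵥ ·) h1
    simp only [Matrix.mulVec_mulVec, mul_eq_one_comm.mp hN.1, Matrix.one_mulVec,
      Matrix.mulVec_sub, hx, neg_one_smul] at h2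
    have h3 : ∀ a b c : Fin (d + 1) → ℂ, a = -c - b → b = -a - c := by
      rintro _ b c rfl
      abel
    exact h3 _ _ _ h2
  set y := imVec u with hy
  have hyu : ofRealVec y = (2 * Complex.I)⁻¹ • (u - star u) := by
    funext i
    simp only [hy, ofRealVec, imVec, Complex.im_eq_sub_conj, div_eq_inv_mul, Pi.smul_apply,
      Pi.sub_apply, Pi.star_apply, Complex.star_def, smul_eq_mul]
  have hNy : N *ᵥ ofRealVec y = -ofRealVec y - Complex.I • ofRealVec x := by
    rw [hyu, Matrix.mulVec_smul, Matrix.mulVec_sub, hNu, hNsu]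
    match_scalars
    · field_simp
      linear_combination (2 : ℂ) * Complex.I_sq
    · ring
    · ring
  have hxu : minkowskiDot (ofRealVec x) u = 0 := by
    have h1 := minkowskiDot_mulVec_mulVec hNL (ofRealVec x) u
    rw [hNu, hx, minkowskiDot_smul_left, minkowskiDot_sub_right, minkowskiDot_ofRealVec, hxx] at h1
    have h2 := minkowskiDot_mulVec_mulVec hNL u u
    rw [hNu, minkowskiDot_sub_left, minkowskiDot_sub_right, minkowskiDot_sub_right,
      minkowskiDot_ofRealVec, hxx, minkowskiDot_comm u (ofRealVec x)] at h2
    have h3 : (2 : ℂ) * minkowskiDot (ofRealVec x) u = 0 := by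
      push_cast at h2
      linear_combination -h2
    simpa using h3
  have hxy : minkowskiDot x y = 0 := by rw [hy, ← im_minkowskiDot_ofRealVec, hxu]; rfl
  have hyneg : minkowskiDot y y < 0 := by
    refine lt_of_le_of_ne (minkowskiDot_self_nonpos_of_orthogonal hx0 hxx.ge hxy) fun h => ?_
    obtain ⟨c, hc⟩ := exists_smul_of_minkowskiDot_eq_zero hx0 hxx.ge hxy h.ge
    have h1 : ofRealVec y = (c : ℂ) • ofRealVec x := by rw [hc]; funext i; simp [ofRealVec]
    rw [h1, Matrix.mulVec_smul, hx] at hNy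
    have h2 : Complex.I • ofRealVec x = 0 := by
      have : Complex.I • ofRealVec x
          = -((c : ℂ) • ofRealVec x) - (c : ℂ) • (-1 : ℂ) • ofRealVec x := by
        rw [hNy]; abel
      rw [this]; module
    exact (smul_ne_zero Complex.I_ne_zero (ofRealVec_ne_zero hx0)) h2
  obtain ⟨x', hx'⟩ := exists_mulVec_eq_I_smul hM hx
  have hx'0 : x' ≠ 0 := by
    rintro rfl
    refine mulVec_ne_zero_of_lorentz hM (ofRealVec_ne_zero hx0) ?_
    rw [hx']; funext i; simp [ofRealVec]
  have hx'x' : minkowskiDot x' x' = 0 := by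
    rw [minkowskiDot_of_mulVec_eq_I_smul hM hx' hx', hxx, neg_zero]
  -- `M y + conj (M y) = -x'`, so the real part of `M y` is `-x'/2`
  have hMy : M *ᵥ ofRealVec y = -star (M *ᵥ ofRealVec y) - ofRealVec x' := by
    have h1 : ∀ r : Fin (d + 1) → ℝ, conjMatrix d M *ᵥ ofRealVec r = star (M *ᵥ ofRealVec r) :=
      fun r => by rw [← conjMatrix_mulVec, star_ofRealVec]
    conv_lhs => rw [← hMcj]
    rw [← Matrix.mulVec_mulVec, hNy, Matrix.mulVec_sub, Matrix.mulVec_neg, Matrix.mulVec_smul, h1,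
      h1, hx', star_smul, star_ofRealVec, Complex.star_def, Complex.conj_I, smul_smul,
      mul_neg, Complex.I_mul_I, neg_neg, one_smul]
  set q := imVec (M *ᵥ ofRealVec y) with hq
  have hre : reVec (M *ᵥ ofRealVec y) = (-(1 / 2) : ℝ) • x' := by
    funext i
    have := congrArg Complex.re (congrFun hMy i)
    simp only [Pi.sub_apply, Pi.neg_apply, Pi.star_apply, Complex.star_def, Complex.sub_re,
      Complex.neg_re, Complex.conj_re, ofRealVec, Complex.ofReal_re] at this
    simp only [reVec, Pi.smul_apply, smul_eq_mul]
    linarith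
  have hdecomp := ofRealVec_re_add_im (M *ᵥ ofRealVec y)
  rw [hre, ← hq] at hdecomp
  have hMM := minkowskiDot_mulVec_mulVec hM (ofRealVec y) (ofRealVec y)
  rw [← hdecomp] at hMM
  simp only [minkowskiDot_self_add, minkowskiDot_smul_left, minkowskiDot_smul_right,
    minkowskiDot_ofRealVec, hx'x'] at hMM
  have hqq : minkowskiDot q q = -minkowskiDot y y := by
    have := congrArg Complex.re hMM
    simp at this
    linarith
  have hx'q : minkowskiDot x' q = 0 := by
    have := congrArg Complex.im hMM
    simpa using this
  have := minkowskiDot_self_nonpos_of_orthogonal hx'0 hx'x'.ge hx'q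
  linarith

/-- The case of a null real eigenvector for the eigenvalue `-1`: by `add_one_mulVec_ne` and duality,
some real eigenvector for `-1` is not orthogonal to it, and the plane of the two contains a second
null direction. -/
theorem hasNullEigenpair_of_null (hM : minkowskiAdj M * M = 1) {x : Fin (d + 1) → ℝ} (hx0 : x ≠ 0)
    (hxx : minkowskiDot x x = 0)
    (hx : realityDefect M *ᵥ ofRealVec x = (-1 : ℂ) • ofRealVec x) :
    HasNullEigenpair (realityDefect M) := by
  have hN := isImaginaryLorentz_realityDefect hM
  have hnot := add_one_mulVec_ne hM hx0 hxx hx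
  set N := realityDefect M with hNdef
  have hmem : ofRealVec x ∉ LinearMap.range (N + 1).mulVecLin := by
    rintro ⟨u, hu⟩
    exact hnot u hu
  obtain ⟨f, hfx, hf⟩ := Submodule.exists_le_ker_of_notMem hmem
  -- the functional `f` is the product with a vector `u`
  obtain ⟨u, hu⟩ : ∃ u, ∀ z, f z = minkowskiDot u z := by
    refine ⟨minkowskiMetric ℂ d *ᵥ fun i => f (Pi.single i 1), fun z => ?_⟩
    rw [minkowskiDot_comm, minkowskiDot_eq_dotProduct, Matrix.mulVec_mulVec,
      minkowskiMetric_mul_self, Matrix.one_mulVec]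
    conv_lhs => rw [← Matrix.one_mulVec z]
    rw [LinearMap.pi_apply_eq_sum_univ f (1 *ᵥ z)]
    simp only [dotProduct, Matrix.one_mulVec, smul_eq_mul]
    refine Finset.sum_congr rfl fun i _ => ?_
    congr 2
    funext j
    simp [Pi.single_apply, eq_comm]
  have hadj : minkowskiAdj (N + 1) *ᵥ u = 0 := by
    refine eq_of_forall_minkowskiDot fun z => ?_
    rw [← minkowskiDot_mulVec_left, minkowskiDot_comm, ← hu, minkowskiDot_zero_right]
    exact hf ⟨z, rfl⟩
  have hNu : N *ᵥ u = (-1 : ℂ) • u := by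
    rw [minkowskiAdj_add, minkowskiAdj_one, hN.2, Matrix.add_mulVec, Matrix.one_mulVec] at hadj
    have h2 := congrArg (N *ᵥ ·) hadj
    simp only [Matrix.mulVec_add, Matrix.mulVec_mulVec, mul_eq_one_comm.mp hN.1, Matrix.one_mulVec,
      Matrix.mulVec_zero] at h2
    rw [neg_one_smul]
    exact eq_neg_of_add_eq_zero_right h2
  obtain ⟨hre, him⟩ := reVec_imVec_eigenvector_neg_one hN.1 hNu
  obtain ⟨y, hy, hxy⟩ : ∃ y : Fin (d + 1) → ℝ, N *ᵥ ofRealVec y = (-1 : ℂ) • ofRealVec y ∧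
      minkowskiDot x y ≠ 0 := by
    by_contra! h
    refine hfx ?_
    rw [hu, minkowskiDot_comm, ← ofRealVec_re_add_im u, minkowskiDot_add_right,
      minkowskiDot_smul_right, minkowskiDot_ofRealVec, minkowskiDot_ofRealVec, h _ hre, h _ him]
    simp
  set c := minkowskiDot y y / (2 * minkowskiDot x y) with hc
  refine ⟨x, y - c • x, -1, hxx, ?_, ?_, by simp, by norm_num, hx, ?_⟩
  · simp only [minkowskiDot_sub_left, minkowskiDot_sub_right, minkowskiDot_smul_left,
      minkowskiDot_smul_right, hxx, minkowskiDot_comm y x, hc]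
    field_simp
    ring
  · rw [minkowskiDot_sub_right, minkowskiDot_smul_right, hxx, mul_zero, sub_zero]
    exact hxy
  · have h1 : ofRealVec (y - c • x) = ofRealVec y - (c : ℂ) • ofRealVec x := by
      funext i; simp [ofRealVec]
    rw [h1, Matrix.mulVec_sub, Matrix.mulVec_smul, hx, hy, inv_neg, inv_one]
    module

/-- The case of a real eigenvector `x` for the eigenvalue `-1` that is not null. Composed with the
reflection in `x`, the matrix `N = M̄⁻¹ M` has determinant `-1`, hence again the eigenvalue `-1`; so
there is a real eigenvector `y ⟂ x`. As `M` changes the signs of the squares of both, one is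
timelike and the other spacelike, and their plane contains two null directions. -/
theorem hasNullEigenpair_of_not_null (hM : minkowskiAdj M * M = 1) (hMdet : M.det = 1)
    {x : Fin (d + 1) → ℝ} (hxx : minkowskiDot x x ≠ 0)
    (hx : realityDefect M *ᵥ ofRealVec x = (-1 : ℂ) • ofRealVec x) :
    HasNullEigenpair (realityDefect M) := by
  have hN := isImaginaryLorentz_realityDefect hM
  have hNL : minkowskiAdj (realityDefect M) * realityDefect M = 1 := by rw [hN.2, hN.1]
  have hNdet : (realityDefect M).det = 1 := by
    rw [realityDefect, Matrix.det_mul, det_conjMatrix, det_minkowskiAdj, hMdet]; simp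
  set N := realityDefect M with hNdef
  have hxc : minkowskiDot (ofRealVec x) (ofRealVec x) ≠ 0 := by
    rw [minkowskiDot_ofRealVec]; exact_mod_cast hxx
  set r := minkowskiReflection (ofRealVec x) with hr
  have hrL : minkowskiAdj r * r = 1 := by
    rw [hr, minkowskiAdj_minkowskiReflection, minkowskiReflection_mul_self hxc]
  have hNr := minkowskiAdj_mul_self_mul hNL hrL
  have hdet : (1 + N * r).det = 0 := by
    have h1 : 1 + N * r = (minkowskiAdj (N * r) + 1) * (N * r) := by
      rw [add_mul, hNr, one_mul]
    have h2 : (minkowskiAdj (N * r) + 1).det = (1 + N * r).det := by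
      rw [← det_minkowskiAdj (1 + N * r), minkowskiAdj_add, minkowskiAdj_one,
        add_comm 1 (minkowskiAdj (N * r))]
    have h3 := congrArg Matrix.det h1
    rw [Matrix.det_mul, h2, Matrix.det_mul, hNdet, hr, det_minkowskiReflection hxc, ← hr] at h3
    have h4 : 2 * (1 + N * r).det = 0 := by linear_combination h3
    simpa using h4
  obtain ⟨u, hu, hu0⟩ := Matrix.exists_mulVec_eq_zero_iff.mpr hdet
  have hru : (N * r) *ᵥ u = -u := by
    rw [Matrix.add_mulVec, Matrix.one_mulVec] at hu0
    exact eq_neg_of_add_eq_zero_right hu0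
  have hrx : (N * r) *ᵥ ofRealVec x = ofRealVec x := by
    have h1 : r *ᵥ ofRealVec x = (-1 : ℂ) • ofRealVec x := by
      rw [hr, minkowskiReflection_mulVec, div_mul_cancel₀ _ hxc]
      module
    rw [← Matrix.mulVec_mulVec, h1, Matrix.mulVec_smul, hx]
    module
  have hxu : minkowskiDot (ofRealVec x) u = 0 := by
    have h1 := minkowskiDot_mulVec_mulVec hNr (ofRealVec x) u
    rw [hru, hrx, minkowskiDot_neg_right] at h1
    have h2 : 2 * minkowskiDot (ofRealVec x) u = 0 := by linear_combination -h1
    simpa using h2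
  have hNu : N *ᵥ u = (-1 : ℂ) • u := by
    have h1 : r *ᵥ u = u := by rw [hr, minkowskiReflection_mulVec, hxu]; simp
    rw [← Matrix.mulVec_mulVec, h1] at hru
    rw [hru, neg_one_smul]
  obtain ⟨hre, him⟩ := reVec_imVec_eigenvector_neg_one hN.1 hNu
  obtain ⟨y, hy0, hy, hxy⟩ : ∃ y : Fin (d + 1) → ℝ, y ≠ 0 ∧
      N *ᵥ ofRealVec y = (-1 : ℂ) • ofRealVec y ∧ minkowskiDot x y = 0 := by
    rw [← ofRealVec_re_add_im u, minkowskiDot_add_right, minkowskiDot_smul_right,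
      minkowskiDot_ofRealVec, minkowskiDot_ofRealVec] at hxu
    have h1 : minkowskiDot x (reVec u) = 0 := by simpa using congrArg Complex.re hxu
    have h2 : minkowskiDot x (imVec u) = 0 := by simpa using congrArg Complex.im hxu
    by_cases h0 : reVec u = 0
    · refine ⟨imVec u, fun h3 => hu ?_, him, h2⟩
      rw [← ofRealVec_re_add_im u, h0, h3]
      funext i; simp [ofRealVec]
    · exact ⟨reVec u, h0, hre, h1⟩
  have hx0 := ne_zero_of_minkowskiDot_self_ne_zero hxx
  -- the two vectors play symmetric roles
  have key : ∀ x y : Fin (d + 1) → ℝ, 0 < minkowskiDot x x → minkowskiDot y y < 0 →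
      minkowskiDot x y = 0 → N *ᵥ ofRealVec x = (-1 : ℂ) • ofRealVec x →
      N *ᵥ ofRealVec y = (-1 : ℂ) • ofRealVec y → HasNullEigenpair N := by
    intro x y hxx hyy hxy hx hy
    set s := √(minkowskiDot x x / -minkowskiDot y y) with hs
    have hss : s * s * minkowskiDot y y = -minkowskiDot x x := by
      rw [hs, Real.mul_self_sqrt (div_nonneg hxx.le (by linarith))]
      field_simp [hyy.ne]
    have hlin : ∀ c : ℝ, ofRealVec (x + c • y) = ofRealVec x + (c : ℂ) • ofRealVec y := by
      intro c; funext i; simp [ofRealVec]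
    refine ⟨x + s • y, x + (-s) • y, -1, ?_, ?_, ?_, by simp, by norm_num, ?_, ?_⟩
    · rw [minkowskiDot_self_add, minkowskiDot_smul_right, minkowskiDot_smul_right,
        minkowskiDot_smul_left, hxy]
      linear_combination hss
    · rw [minkowskiDot_self_add, minkowskiDot_smul_right, minkowskiDot_smul_right,
        minkowskiDot_smul_left, hxy]
      linear_combination hss
    · have h1 : minkowskiDot (x + s • y) (x + (-s) • y) = 2 * minkowskiDot x x := by
        simp only [minkowskiDot_add_left, minkowskiDot_add_right, minkowskiDot_smul_left,
          minkowskiDot_smul_right, hxy, minkowskiDot_comm y x]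
        linear_combination -hss
      rw [h1]
      positivity
    · rw [hlin, Matrix.mulVec_add, Matrix.mulVec_smul, hx, hy]
      module
    · rw [hlin, Matrix.mulVec_add, Matrix.mulVec_smul, hx, hy, inv_neg, inv_one]
      module
  rcases lt_or_gt_of_ne hxx with h | h
  · obtain ⟨x', hx'⟩ := exists_mulVec_eq_I_smul hM hx
    obtain ⟨y', hy'⟩ := exists_mulVec_eq_I_smul hM hy
    have hyy : 0 < minkowskiDot y y := by
      have h1 : 0 < minkowskiDot x' x' := by
        rw [minkowskiDot_of_mulVec_eq_I_smul hM hx' hx']; linarith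
      have h2 : minkowskiDot x' y' = 0 := by
        rw [minkowskiDot_of_mulVec_eq_I_smul hM hx' hy', hxy, neg_zero]
      have h3 : y' ≠ 0 := by
        rintro rfl
        refine mulVec_ne_zero_of_lorentz hM (ofRealVec_ne_zero hy0) ?_
        rw [hy']; funext i; simp [ofRealVec]
      have h4 := minkowskiDot_self_neg_of_orthogonal h1 h2 h3
      rw [minkowskiDot_of_mulVec_eq_I_smul hM hy' hy'] at h4
      linarith
    exact key y x hyy h (by rw [minkowskiDot_comm, hxy]) hy hx
  · exact key x y h (minkowskiDot_self_neg_of_orthogonal h hxy hy0) hxy hx hy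

/-- The eigenvalues of `M̄⁻¹ M` are all positive unless `M` involves a complex boost. -/
theorem positiveEigenvalues_or_hasNullEigenpair (hM : minkowskiAdj M * M = 1) (hMdet : M.det = 1) :
    PositiveEigenvalues (realityDefect M) ∨ HasNullEigenpair (realityDefect M) := by
  by_contra! h
  obtain ⟨hpos, hnull⟩ := h
  unfold PositiveEigenvalues at hpos
  push Not at hpos
  obtain ⟨v, a, hv, ha, hapos⟩ := hpos
  have hapos' : ¬ ∃ r : ℝ, 0 < r ∧ a = r := fun ⟨r, hr, h⟩ => hapos r hr h
  by_cases ha2 : a * a = 1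
  · rcases mul_self_eq_one_iff.mp ha2 with rfl | rfl
    · exact hapos' ⟨1, one_pos, by simp⟩
    · obtain ⟨hre, him⟩ := reVec_imVec_eigenvector_neg_one
        (isImaginaryLorentz_realityDefect hM).1 ha
      obtain ⟨x, hx0, hx⟩ : ∃ x : Fin (d + 1) → ℝ, x ≠ 0 ∧
          realityDefect M *ᵥ ofRealVec x = (-1 : ℂ) • ofRealVec x := by
        by_cases h0 : reVec v = 0
        · refine ⟨imVec v, fun h3 => hv ?_, him⟩
          rw [← ofRealVec_re_add_im v, h0, h3]
          funext i; simp [ofRealVec]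
        · exact ⟨reVec v, h0, hre⟩
      by_cases hxx : minkowskiDot x x = 0
      · exact hnull (hasNullEigenpair_of_null hM hx0 hxx hx)
      · exact hnull (hasNullEigenpair_of_not_null hM hMdet hxx hx)
  · exact hnull (hasNullEigenpair_of_sq_ne_one hM hv ha ha2 hapos')

end Eigenvalues

/-! ### Existence of the polar decomposition and of the path -/

/-- Every complex Lorentz matrix of determinant `1` that maps some point of the forward tube into
the forward tube has a polar decomposition. -/
theorem hasPolarDecomposition {d : ℕ} {M : Matrix (Fin (d + 1)) (Fin (d + 1)) ℂ}
    (hM : minkowskiAdj M * M = 1) (hMdet : M.det = 1) {z : Fin (d + 1) → ℂ}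
    (hz : z ∈ forwardTube d) (hMz : M *ᵥ z ∈ forwardTube d) : HasPolarDecomposition M := by
  rcases positiveEigenvalues_or_hasNullEigenpair hM hMdet with hpos | hnull
  · exact hasPolarDecomposition_of_positiveEigenvalues hM hpos hz hMz
  obtain ⟨n, m, μ, hn, hm, hk, hμ, hμ1, hNn, hNm⟩ := hnull
  -- the signs of `n` and `m` are chosen so that `n + m` is a future timelike vector
  wlog hkpos : 0 < minkowskiDot n m generalizing m
  · refine this (-m) (by simpa [minkowskiDot_neg_left, minkowskiDot_neg_right] using hm)
      (by simpa [minkowskiDot_neg_right] using hk) ?_ ?_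
    · have h1 : ofRealVec (-m) = -ofRealVec m := by funext i; simp [ofRealVec]
      rw [h1, Matrix.mulVec_neg, hNm, smul_neg]
    · rw [minkowskiDot_neg_right]
      linarith [lt_of_le_of_ne (not_lt.mp hkpos) hk]
  have hsum : ∀ x y : Fin (d + 1) → ℝ, minkowskiDot x x = 0 → minkowskiDot y y = 0 →
      0 < minkowskiDot x y → 0 < minkowskiDot (x + y) (x + y) := fun x y hx hy hxy => by
    rw [minkowskiDot_self_add, hx, hy]; linarith
  wlog hfut : n + m ∈ futureCone d generalizing n m
  · have h1 : ∀ x : Fin (d + 1) → ℝ, ofRealVec (-x) = -ofRealVec x := fun x => by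
      funext i; simp [ofRealVec]
    refine this (-n) (by simpa [minkowskiDot_neg_left, minkowskiDot_neg_right] using hn) ?_ (-m)
      (by simpa [minkowskiDot_neg_left, minkowskiDot_neg_right] using hm)
      (by simpa [minkowskiDot_neg_left, minkowskiDot_neg_right] using hk) ?_
      (by simpa [minkowskiDot_neg_left, minkowskiDot_neg_right] using hkpos) ?_
    · rw [h1, Matrix.mulVec_neg, hNn, smul_neg]
    · rw [h1, Matrix.mulVec_neg, hNm, smul_neg]
    · rw [← neg_add]
      exact (mem_futureCone_or_neg_mem (hsum n m hn hm hkpos)).resolve_left hfut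
  -- with `β² = μ`, the vectors `β⁻¹ M n` and `β M m` are real
  obtain ⟨β, hβμ, hβ⟩ := exists_unit_sqrt hμ
  have hβ1 : ∀ β : ℂ, β * β = μ → β ≠ -1 := by
    rintro _ h rfl
    exact hμ1 (by rw [← h]; norm_num)
  have hμ0 : μ ≠ 0 := right_ne_zero_of_mul_eq_one hμ
  have hβ0 : β ≠ 0 := right_ne_zero_of_mul_eq_one hβ
  have hβinv : (starRingEnd ℂ) β = β⁻¹ := eq_inv_of_mul_eq_one_left hβ
  have hμinv : (starRingEnd ℂ) μ = μ⁻¹ := eq_inv_of_mul_eq_one_left hμ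
  have hstar : ∀ (x : Fin (d + 1) → ℝ) (a : ℂ), a ≠ 0 →
      realityDefect M *ᵥ ofRealVec x = a • ofRealVec x →
      star (M *ᵥ ofRealVec x) = (starRingEnd ℂ) a • (M *ᵥ ofRealVec x) := fun x a ha hx => by
    have h1 := mulVec_star_of_realityDefect hM ha hx
    rw [star_ofRealVec] at h1
    have h2 : (starRingEnd ℂ) a ≠ 0 := by simpa using ha
    conv_rhs => rw [h1, smul_smul, mul_inv_cancel₀ h2, one_smul]
  obtain ⟨n', hn'⟩ := exists_ofRealVec_eq (z := β⁻¹ • (M *ᵥ ofRealVec n)) (by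
    rw [star_smul, hstar n μ hμ0 hNn, smul_smul, Complex.star_def, map_inv₀, hβinv, inv_inv,
      hμinv, ← hβμ, mul_inv, mul_inv_cancel_left₀ hβ0])
  obtain ⟨m', hm'⟩ := exists_ofRealVec_eq (z := β • (M *ᵥ ofRealVec m)) (by
    rw [star_smul, hstar m μ⁻¹ (inv_ne_zero hμ0) hNm, smul_smul, Complex.star_def, map_inv₀, hβinv,
      hμinv, inv_inv, ← hβμ, inv_mul_cancel_left₀ hβ0])
  have hMn : M *ᵥ ofRealVec n = β • ofRealVec n' := by
    rw [hn', smul_smul, mul_inv_cancel₀ hβ0, one_smul]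
  have hMm : M *ᵥ ofRealVec m = β⁻¹ • ofRealVec m' := by
    rw [hm', smul_smul, inv_mul_cancel₀ hβ0, one_smul]
  have hdot : ∀ (x y x' y' : Fin (d + 1) → ℝ) (a b : ℂ), ofRealVec x' = a • (M *ᵥ ofRealVec x) →
      ofRealVec y' = b • (M *ᵥ ofRealVec y) →
      ((minkowskiDot x' y' : ℝ) : ℂ) = a * b * ((minkowskiDot x y : ℝ) : ℂ) := by
    intro x y x' y' a b hx hy
    rw [← minkowskiDot_ofRealVec, hx, hy, minkowskiDot_smul_left, minkowskiDot_smul_right,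
      minkowskiDot_mulVec_mulVec hM, minkowskiDot_ofRealVec, mul_assoc]
  have hn'n' : minkowskiDot n' n' = 0 := by
    have := hdot _ _ _ _ _ _ hn' hn'
    rw [hn] at this
    simpa using this
  have hm'm' : minkowskiDot m' m' = 0 := by
    have := hdot _ _ _ _ _ _ hm' hm'
    rw [hm] at this
    simpa using this
  have hn'm' : 0 < minkowskiDot n' m' := by
    have := hdot _ _ _ _ _ _ hn' hm'
    rw [inv_mul_cancel₀ hβ0, one_mul] at this
    have h1 : minkowskiDot n' m' = minkowskiDot n m := by exact_mod_cast this
    rw [h1]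
    exact hkpos
  rcases mem_futureCone_or_neg_mem (hsum n' m' hn'n' hm'm' hn'm') with h | h
  · exact hasPolarDecomposition_of_nullPair hM hn hm hk hfut h hβ (hβ1 β hβμ) hMn hMm
  · -- the other square root of `μ` reverses the time orientation of `n'` and `m'`
    have h1 : ∀ x : Fin (d + 1) → ℝ, ofRealVec (-x) = -ofRealVec x := fun x => by
      funext i; simp [ofRealVec]
    rw [neg_add] at h
    refine hasPolarDecomposition_of_nullPair hM hn hm hk hfut h (β := -β) (by simpa using hβ)
      (hβ1 (-β) (by rw [neg_mul_neg, hβμ])) ?_ ?_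
    · rw [h1, hMn, smul_neg, neg_smul, neg_neg]
    · rw [h1, hMm, inv_neg, smul_neg, neg_smul, neg_neg]

theorem mainTheorem10 (d : ℕ) (M : complexLorentzGroup d)
    (hM : (forwardTube d ∩ lorentzAct M⁻¹ '' forwardTube d).Nonempty) :
    ∃ γ : Path (1 : complexLorentzGroup d) M,
      ∀ z ∈ forwardTube d ∩ lorentzAct M⁻¹ '' forwardTube d,
        ∀ t : unitInterval, lorentzAct (γ t) z ∈ forwardTube d := by
  have hinv : ∀ w, lorentzAct M (lorentzAct M⁻¹ w) = w := fun w => by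
    have h : M.1.1 * (M⁻¹).1.1 = 1 :=
      congrArg (fun A : complexLorentzGroup d => A.1.1) (mul_inv_cancel M)
    rw [lorentzAct, lorentzAct, Matrix.mulVec_mulVec, h, Matrix.one_mulVec]
  have hmem : ∀ z ∈ forwardTube d ∩ lorentzAct M⁻¹ '' forwardTube d,
      z ∈ forwardTube d ∧ lorentzAct M z ∈ forwardTube d := by
    rintro _ ⟨hz, w, hw, rfl⟩
    exact ⟨hz, by rwa [hinv]⟩
  obtain ⟨z, hz⟩ := hM
  obtain ⟨A, C, S, hA, hC, hS, hCS, h1, hdet, hpolar⟩ := hasPolarDecomposition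
    (minkowskiAdj_mul_self_of_forall M.2) M.1.2 (hmem z hz).1 (hmem z hz).2
  obtain ⟨γ, hγ⟩ := joinedIn_of_polar M hA hC hS hCS h1 hdet hpolar
  exact ⟨γ, fun z hz t => hγ t z (hmem z hz).1 (hmem z hz).2⟩
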